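/- For $C_1,C_2>0$ there is a constant $C>0$, depending only on $C_1$ and $C_2$, with the following property. Let $\lambda\in\mathbb R\setminus\{0\}$, $\mu>0$, $b_1>0$, let $\psi\in C_0^\infty(\mathbb R^3)$, let $K$ be the convex hull of $\operatorname{supp}\psi$, and let $S$ be a real-valued function that is real analytic in a neighborhood of $K$. Suppose that the form $$\Lambda_3(f_1,f_2,f_3)=\int_{\mathbb R^3}e^{i\lambda S(x)}\,\psi(x)\,f_1(x_2,x_3)\,f_2(x_1,x_3)\,f_3(x_1,x_2)\,dx$$ satisfies the local estimate hypotheses in $x_1$ with parameter $\mu$, that is: 1. $\psi$ is supported on a rectangle (with sides parallel to the axes) of width $b_1$ in the $x_1$-direction; 2. $|\partial_{x_1}^n\psi|\le C_1b_1^{-n}$ on $\mathbb R^3$ for $n=0,1,2$; 3. with $D_3=\partial_{x_1}\partial_{x_2}\partial_{x_3}$, one has $|D_3S|\ge\mu$, $|\partial_{x_1}D_3S|\le C_2\mu b_1^{-1}$ and $|\partial_{x_1}^2D_3S|\le C_2\mu b_1^{-2}$ on $K$. Then for all measurable $f_1,f_2,f_3:\mathbb R^2\to\mathbb C$ for which the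 norms on the right-hand side are finite, the integral defining $\Lambda_3(f_1,f_2,f_3)$ converges absolutely and $$|\Lambda_3(f_1,f_2,f_3)|\le C\,(|\lambda|\mu)^{-1/4}\,\|f_1\|_{L^4_{x_2}L^{8/3}_{x_3}}\,\|f_2\|_{L^4_{x_1}L^{8/3}_{x_3}}\,\|f_3\|_{L^2},$$ where $\|f\|_{L^p_xL^q_y}=\big(\int(\int|f(x,y)|^q\,dy)^{p/q}\,dx\big)^{1/p}$. -/

import Mathlib

open MeasureTheory
open scoped ENNReal ContDiff

/-- Euclidean three-space, as triples `(x₁, x₂, x₃)`, with Lebesgue measure. -/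
abbrev R3 : Type := ℝ × ℝ × ℝ

/-- The standard basis vectors of three-space (the indices `0, 1, 2` stand for the
coordinates `x₁, x₂, x₃`). -/
def basisVec : Fin 3 → R3 := ![(1, 0, 0), (0, 1, 0), (0, 0, 1)]

/-- The coordinate functions of three-space. -/
def coord (j : Fin 3) (x : R3) : ℝ := ![x.1, x.2.1, x.2.2] j

/-- The partial derivative `∂_{x_j} F`. -/
noncomputable def partialDeriv {E : Type*} [NormedAddCommGroup E] [NormedSpace ℝ E]
    (j : Fin 3) (F : R3 → E) : R3 → E :=
  fun x => fderiv ℝ F x (basisVec j)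

/-- The mixed derivative `D₃ S = ∂_{x₁} ∂_{x₂} ∂_{x₃} S`. -/
noncomputable def D3 (S : R3 → ℝ) : R3 → ℝ :=
  partialDeriv 0 (partialDeriv 1 (partialDeriv 2 S))

/-- The integrand of `Λ₃`: the function `f_j` does not depend on the variable `x_j`. -/
noncomputable def integrand3 (lam : ℝ) (S : R3 → ℝ) (ψ : R3 → ℂ)
    (f₁ f₂ f₃ : ℝ × ℝ → ℂ) (x : R3) : ℂ :=
  Complex.exp (Complex.I * ((lam * S x : ℝ) : ℂ)) * ψ x *
    (f₁ (x.2.1, x.2.2) * f₂ (x.1, x.2.2) * f₃ (x.1, x.2.1))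

/-- The trilinear oscillatory form `Λ₃` with parameter `lam`, phase `S` and cutoff `ψ`. -/
noncomputable def Lambda3 (lam : ℝ) (S : R3 → ℝ) (ψ : R3 → ℂ)
    (f₁ f₂ f₃ : ℝ × ℝ → ℂ) : ℂ :=
  ∫ x : R3, integrand3 lam S ψ f₁ f₂ f₃ x

/-- The mixed norm `‖f‖_{L^p_x L^q_y} = (∫ (∫ |f(x,y)|^q dy)^{p/q} dx)^{1/p}`
(outer variable: the first one), with values in `[0, ∞]`. -/
noncomputable def mixedNorm (p q : ℝ) (f : ℝ × ℝ → ℂ) : ℝ≥0∞ :=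
  (∫⁻ x : ℝ, (∫⁻ y : ℝ, ‖f (x, y)‖ₑ ^ q) ^ (p / q)) ^ (1 / p)

/-- The local estimate hypotheses in `x_j` with parameter `μ`, width `b` and constants `C₁`, `C₂`.
The bounds on the phase are required on the convex hull of the support of the cutoff. -/
structure LocalEstimateHyp (j : Fin 3) (S : R3 → ℝ) (ψ : R3 → ℂ) (b μ C₁ C₂ : ℝ) : Prop where
  /-- The cutoff is supported on a rectangle of width `b` in the direction `x_j`. -/
  support_subset : ∃ lo hi : R3, coord j hi - coord j lo = b ∧ tsupport ψ ⊆ Set.Icc lo hi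
  cutoff_bound : ∀ n : ℕ, n ≤ 2 → ∀ x : R3, ‖(partialDeriv j)^[n] ψ x‖ ≤ C₁ * (b ^ n)⁻¹
  lower_bound : ∀ x ∈ convexHull ℝ (tsupport ψ), μ ≤ |D3 S x|
  deriv_bound : ∀ x ∈ convexHull ℝ (tsupport ψ), |partialDeriv j (D3 S) x| ≤ C₂ * μ * b⁻¹
  deriv2_bound : ∀ x ∈ convexHull ℝ (tsupport ψ),
    |partialDeriv j (partialDeriv j (D3 S)) x| ≤ C₂ * μ * (b ^ 2)⁻¹

/-! Since `f₃` does not depend on `x₃`, Cauchy–Schwarz in `(x₁, x₂)` reduces the claim to the `L²`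
norm of `G(x₁, x₂) = ∫ e^{iλS} ψ f₁ f₂ dx₃`. Expanding `‖G‖₂²` produces two copies `s, t` of `x₃`
(`lintegral_enorm_integral_sq_le`). For fixed `s ≠ t` what remains is a bilinear form in the
functions `f₁(·, s) conj f₁(·, t)` of `x₂` and `f₂(·, s) conj f₂(·, t)` of `x₁`. A second
Cauchy–Schwarz expansion of this form, with `x₂`-copies `y, z`, leaves an oscillatory integral in
`x₁` alone. Its phase is the mixed second difference of `S` over the rectangle with sides `y - z`
and `s - t`, so its `x₁`-derivative is `(y - z)(s - t)` times a value of `D3 S`, at least `μ |y - z|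
|s - t|` in size. Two integrations by parts bound the integral by a multiple of `b / (1 + (|λ| μ b
|s - t| |y - z|)²)` (`norm_integral_oscKernel_le`). Integration in `z` cancels `b`, and Schur's test
gives the operator norm `(|λ| μ |s - t|)^{-1/2}` up to a constant (`enorm_bilinear_oscKernel_le`).
The weight `|s - t|^{-1/2}` is absorbed by Cauchy–Schwarz in `(s, t)` and the
Hardy–Littlewood–Sobolev inequality applied to `|f_j|²` on lines parallel to the `x₃`-axis. This
uses the `L^{4/3}` norm of `|f_j|²`, hence the exponent `8/3`; the outer exponent `4` comes from the
remaining integration (`lintegral_rieszKernel_mul_sq_le`). All this is done for bounded functions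
(`enorm_Lambda3_le_of_bounded`); truncation and dominated convergence give the general case. -/

/-! ### Cauchy–Schwarz, the `T T*` method and Schur's test. -/

theorem ENNReal.lintegral_mul_le_sqrt_mul_sqrt {α : Type*} [MeasurableSpace α] (μ : Measure α)
    {f g : α → ℝ≥0∞} (hf : AEMeasurable f μ) (hg : AEMeasurable g μ) :
    ∫⁻ a, f a * g a ∂μ ≤
      (∫⁻ a, f a ^ (2 : ℝ) ∂μ) ^ (1 / 2 : ℝ) * (∫⁻ a, g a ^ (2 : ℝ) ∂μ) ^ (1 / 2 : ℝ) :=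
  ENNReal.lintegral_mul_le_Lp_mul_Lq μ Real.HolderConjugate.two_two hf hg

theorem enorm_integral_mul_le_sqrt_mul_sqrt {α : Type*} [MeasurableSpace α] (μ : Measure α)
    {f g : α → ℂ} (hf : AEStronglyMeasurable f μ) (hg : AEStronglyMeasurable g μ) :
    ‖∫ a, f a * g a ∂μ‖ₑ ≤
      (∫⁻ a, ‖f a‖ₑ ^ (2 : ℝ) ∂μ) ^ (1 / 2 : ℝ) * (∫⁻ a, ‖g a‖ₑ ^ (2 : ℝ) ∂μ) ^ (1 / 2 : ℝ) := by
  refine (enorm_integral_le_lintegral_enorm _).trans ?_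
  simp_rw [enorm_mul]
  exact ENNReal.lintegral_mul_le_sqrt_mul_sqrt μ hf.enorm hg.enorm

/-- Expansion of the square of an `L²` norm of an integral with a parameter. -/
theorem lintegral_enorm_integral_sq_le {X Y : Type*} [MeasurableSpace X] [MeasurableSpace Y]
    (μ : Measure X) (ν : Measure Y) [IsFiniteMeasure μ] [IsFiniteMeasure ν]
    {g : X → Y → ℂ} (hg : StronglyMeasurable (Function.uncurry g)) {M : ℝ}
    (hM : ∀ x y, ‖g x y‖ ≤ M) :
    ∫⁻ x, ‖∫ y, g x y ∂ν‖ₑ ^ (2 : ℝ) ∂μ ≤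
      ∫⁻ p : Y × Y, ‖∫ x, g x p.1 * (starRingEnd ℂ) (g x p.2) ∂μ‖ₑ ∂(ν.prod ν) := by
  have hsm : StronglyMeasurable
      (Function.uncurry fun (x : X) (p : Y × Y) => g x p.1 * (starRingEnd ℂ) (g x p.2)) := by
    have h1 : StronglyMeasurable fun q : X × Y × Y => g q.1 q.2.1 :=
      hg.comp_measurable (f := Function.uncurry g) (g := fun q : X × Y × Y => (q.1, q.2.1))
        (by fun_prop)
    have h2 : StronglyMeasurable fun q : X × Y × Y => g q.1 q.2.2 :=
      hg.comp_measurable (f := Function.uncurry g) (g := fun q : X × Y × Y => (q.1, q.2.2))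
        (by fun_prop)
    exact h1.mul (Complex.continuous_conj.comp_stronglyMeasurable h2)
  -- Boundedness on a finite measure space is what justifies exchanging the `x` integral with the
  -- double integral over `Y × Y`.
  have hint : Integrable
      (Function.uncurry fun (x : X) (p : Y × Y) => g x p.1 * (starRingEnd ℂ) (g x p.2))
      (μ.prod (ν.prod ν)) := by
    refine Integrable.of_bound hsm.aestronglyMeasurable (M * M) (Filter.Eventually.of_forall ?_)
    rintro ⟨x, p⟩
    simp only [Function.uncurry_apply_pair, norm_mul, RCLike.norm_conj]
    exact mul_le_mul (hM _ _) (hM _ _) (norm_nonneg _) ((norm_nonneg _).trans (hM x p.1))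
  have hG : StronglyMeasurable fun x => ∫ y, g x y ∂ν := hg.integral_prod_right
  have hGb : ∀ x, ‖∫ y, g x y ∂ν‖ ≤ M * ν.real Set.univ := fun x =>
    norm_integral_le_of_norm_le_const (Filter.Eventually.of_forall fun y => hM x y)
  have hsq : Integrable (fun x => ‖∫ y, g x y ∂ν‖ ^ 2) μ := by
    refine Integrable.of_bound (hG.norm.pow 2).aestronglyMeasurable ((M * ν.real Set.univ) ^ 2)
      (Filter.Eventually.of_forall fun x => ?_)
    rw [norm_pow, norm_norm]
    exact pow_le_pow_left₀ (norm_nonneg _) (hGb x) 2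
  have e1 : ∫⁻ x, ‖∫ y, g x y ∂ν‖ₑ ^ (2 : ℝ) ∂μ
      = ENNReal.ofReal (∫ x, ‖∫ y, g x y ∂ν‖ ^ 2 ∂μ) := by
    rw [ofReal_integral_eq_lintegral_ofReal hsq
      (Filter.Eventually.of_forall fun x => by positivity)]
    refine lintegral_congr fun x => ?_
    rw [ENNReal.ofReal_pow (norm_nonneg _), ofReal_norm]
    exact ENNReal.rpow_natCast _ 2
  have e2 : ((∫ x, ‖∫ y, g x y ∂ν‖ ^ 2 ∂μ : ℝ) : ℂ)
      = ∫ p : Y × Y, ∫ x, g x p.1 * (starRingEnd ℂ) (g x p.2) ∂μ ∂(ν.prod ν) := by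
    rw [← integral_integral_swap hint, ← integral_complex_ofReal]
    refine integral_congr_ae (Filter.Eventually.of_forall fun x => ?_)
    change ((‖∫ y, g x y ∂ν‖ ^ 2 : ℝ) : ℂ) = ∫ p : Y × Y, g x p.1 * (starRingEnd ℂ) (g x p.2) ∂_
    rw [integral_prod_mul (fun y => g x y) (fun y => (starRingEnd ℂ) (g x y)), integral_conj,
      Complex.mul_conj, Complex.normSq_eq_norm_sq]
  rw [e1, ← Real.enorm_of_nonneg (integral_nonneg fun x => by positivity)]
  have e3 : ‖∫ x, ‖∫ y, g x y ∂ν‖ ^ 2 ∂μ‖ₑ = ‖((∫ x, ‖∫ y, g x y ∂ν‖ ^ 2 ∂μ : ℝ) : ℂ)‖ₑ := by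
    rw [← ofReal_norm, ← ofReal_norm, Complex.norm_real]
  rw [e3, e2]
  exact enorm_integral_le_lintegral_enorm _

/-- The factor `1/2` of the sharp inequality is dropped; this only costs the factor `2` in Schur's
test. -/
theorem ENNReal.mul_le_sq_add_sq (a b : ℝ≥0∞) : a * b ≤ a ^ (2 : ℝ) + b ^ (2 : ℝ) := by
  rw [ENNReal.rpow_two, ENNReal.rpow_two, sq, sq]
  rcases le_total a b with h | h
  · exact (mul_le_mul_left h b).trans le_add_self
  · exact (mul_le_mul_right h a).trans le_self_add

/-- Schur's test for a symmetric nonnegative kernel. -/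
theorem lintegral_kernel_mul_le {Y : Type*} [MeasurableSpace Y] (ν : Measure Y) [SFinite ν]
    {H : Y → Y → ℝ≥0∞} (hH : Measurable (Function.uncurry H)) (hsymm : ∀ y z, H y z = H z y)
    {A : ℝ≥0∞} (hA : ∀ y, ∫⁻ z, H y z ∂ν ≤ A) {u : Y → ℝ≥0∞} (hu : Measurable u) :
    ∫⁻ p : Y × Y, H p.1 p.2 * (u p.1 * u p.2) ∂(ν.prod ν) ≤
      2 * A * ∫⁻ y, u y ^ (2 : ℝ) ∂ν := by
  have hHm : Measurable fun p : Y × Y => H p.1 p.2 := hH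
  have hu2 : Measurable fun y => u y ^ (2 : ℝ) := hu.pow_const _
  have hHu : Measurable fun p : Y × Y => H p.1 p.2 * u p.1 ^ (2 : ℝ) :=
    hHm.mul (hu2.comp measurable_fst)
  have h1 : ∫⁻ p : Y × Y, H p.1 p.2 * u p.1 ^ (2 : ℝ) ∂(ν.prod ν) ≤
      A * ∫⁻ y, u y ^ (2 : ℝ) ∂ν := by
    rw [lintegral_prod _ hHu.aemeasurable,
      ← lintegral_const_mul _ hu2]
    refine lintegral_mono fun y => ?_
    have : Measurable fun z => H y z := hHm.comp (measurable_const.prodMk measurable_id)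
    dsimp only
    rw [lintegral_mul_const _ this]
    gcongr
    exact hA y
  have h2 : ∫⁻ p : Y × Y, H p.1 p.2 * u p.2 ^ (2 : ℝ) ∂(ν.prod ν) ≤
      A * ∫⁻ y, u y ^ (2 : ℝ) ∂ν := by
    rw [← lintegral_prod_swap]
    simp only [Prod.fst_swap, Prod.snd_swap]
    simp_rw [hsymm _ (Prod.fst _)]
    exact h1
  calc _ ≤ ∫⁻ p : Y × Y, (H p.1 p.2 * u p.1 ^ (2 : ℝ) + H p.1 p.2 * u p.2 ^ (2 : ℝ))
        ∂(ν.prod ν) := by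
        refine lintegral_mono fun p => ?_
        rw [← mul_add]
        gcongr
        exact ENNReal.mul_le_sq_add_sq _ _
    _ ≤ A * ∫⁻ y, u y ^ (2 : ℝ) ∂ν + A * ∫⁻ y, u y ^ (2 : ℝ) ∂ν := by
        rw [lintegral_add_left hHu]
        exact add_le_add h1 h2
    _ = _ := by rw [two_mul, add_mul]

/-- The `T T*` method combined with Schur's test. -/
theorem enorm_integral_bilinear_le {X Y : Type*} [MeasurableSpace X] [MeasurableSpace Y]
    (μ : Measure X) (ν : Measure Y) [IsFiniteMeasure μ] [IsFiniteMeasure ν]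
    {k : X → Y → ℂ} (hk : StronglyMeasurable (Function.uncurry k)) {M N : ℝ}
    (hM : ∀ x y, ‖k x y‖ ≤ M) {F : Y → ℂ} (hF : StronglyMeasurable F) (hN : ∀ y, ‖F y‖ ≤ N)
    {G : X → ℂ} (hG : StronglyMeasurable G)
    {H : Y → Y → ℝ≥0∞} (hH : Measurable (Function.uncurry H)) (hsymm : ∀ y z, H y z = H z y)
    (hkH : ∀ y z, ‖∫ x, k x y * (starRingEnd ℂ) (k x z) ∂μ‖ₑ ≤ H y z)
    {A : ℝ≥0∞} (hA : ∀ y, ∫⁻ z, H y z ∂ν ≤ A) :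
    ‖∫ x, G x * ∫ y, k x y * F y ∂ν ∂μ‖ₑ ≤
      (2 * A) ^ (1 / 2 : ℝ) * (∫⁻ y, ‖F y‖ₑ ^ (2 : ℝ) ∂ν) ^ (1 / 2 : ℝ) *
        (∫⁻ x, ‖G x‖ₑ ^ (2 : ℝ) ∂μ) ^ (1 / 2 : ℝ) := by
  have hkF : StronglyMeasurable (Function.uncurry fun x y => k x y * F y) :=
    hk.mul (hF.comp_measurable measurable_snd)
  have hb : ∀ x y, ‖k x y * F y‖ ≤ M * N := fun x y => by
    rw [norm_mul]
    exact mul_le_mul (hM _ _) (hN _) (norm_nonneg _) ((norm_nonneg _).trans (hM x y))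
  refine (enorm_integral_mul_le_sqrt_mul_sqrt μ hG.aestronglyMeasurable
    hkF.integral_prod_right.aestronglyMeasurable).trans ?_
  rw [mul_comm]
  gcongr
  rw [← ENNReal.mul_rpow_of_nonneg _ _ (by norm_num)]
  gcongr
  refine (lintegral_enorm_integral_sq_le μ ν hkF hb).trans
    (le_trans (lintegral_mono fun p => ?_)
      (lintegral_kernel_mul_le ν hH hsymm hA hF.measurable.enorm))
  -- The factors `F` do not depend on `x` and leave the inner integral, so that only the composed
  -- kernel, controlled by `H`, remains there.
  have : ∀ x, k x p.1 * F p.1 * (starRingEnd ℂ) (k x p.2 * F p.2)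
      = k x p.1 * (starRingEnd ℂ) (k x p.2) * (F p.1 * (starRingEnd ℂ) (F p.2)) := fun x => by
    rw [map_mul]; ring
  simp_rw [this]
  rw [integral_mul_const, enorm_mul, enorm_mul, RCLike.enorm_conj]
  gcongr
  exact hkH _ _

/-! ### Fractional integration of order one half on the line. -/

theorem lintegral_comp_abs (φ : ℝ → ℝ≥0∞) :
    ∫⁻ x : ℝ, φ |x| = 2 * ∫⁻ x in Set.Ioi (0 : ℝ), φ x := by
  have h1 : ∫⁻ x in Set.Ioi (0 : ℝ), φ |x| = ∫⁻ x in Set.Ioi (0 : ℝ), φ x :=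
    setLIntegral_congr_fun measurableSet_Ioi fun x hx => by
      rw [abs_of_pos (Set.mem_Ioi.1 hx)]
  have h2 : ∫⁻ x in Set.Iic (0 : ℝ), φ |x| = ∫⁻ x in Set.Ioi (0 : ℝ), φ |x| := by
    rw [← (Measure.measurePreserving_neg (volume : Measure ℝ)).setLIntegral_comp_preimage_emb
      (MeasurableEquiv.neg ℝ).measurableEmbedding]
    simp only [abs_neg, Set.neg_preimage, Set.neg_Iic, neg_zero]
    exact setLIntegral_congr Ioi_ae_eq_Ici.symm
  rw [← lintegral_add_compl _ (measurableSet_Iic (a := (0 : ℝ))), Set.compl_Iic, h2, h1, two_mul]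

theorem lintegral_Ioc_rpow_neg_half {R : ℝ} (hR : 0 < R) :
    ∫⁻ x in Set.Ioc 0 R, ENNReal.ofReal (x ^ (-(1 / 2) : ℝ)) =
      ENNReal.ofReal (2 * R ^ (1 / 2 : ℝ)) := by
  have hi : IntervalIntegrable (fun x : ℝ => x ^ (-(1 / 2) : ℝ)) volume 0 R :=
    intervalIntegral.intervalIntegrable_rpow' (by norm_num)
  rw [← ofReal_integral_eq_lintegral_ofReal
    ((intervalIntegrable_iff_integrableOn_Ioc_of_le hR.le).1 hi)
    ((ae_restrict_mem measurableSet_Ioc).mono fun x hx => Real.rpow_nonneg hx.1.le _),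
    ← intervalIntegral.integral_of_le hR.le, integral_rpow (Or.inl (by norm_num))]
  congr 1
  norm_num
  ring

theorem lintegral_Ioi_rpow_neg_two {R : ℝ} (hR : 0 < R) :
    ∫⁻ x in Set.Ioi R, ENNReal.ofReal (x ^ (-2 : ℝ)) = ENNReal.ofReal R⁻¹ := by
  rw [← ofReal_integral_eq_lintegral_ofReal (integrableOn_Ioi_rpow_of_lt (by norm_num) hR)
    ((ae_restrict_mem measurableSet_Ioi).mono fun x hx =>
      Real.rpow_nonneg (hR.le.trans (Set.mem_Ioi.1 hx).le) _),
    integral_Ioi_rpow_of_lt (by norm_num) hR]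
  norm_num
  rw [Real.rpow_neg_one]

/-- The kernel `|s - t|^{-1/2}` of fractional integration of order one half. -/
noncomputable def rieszKernel (r : ℝ) : ℝ≥0∞ := ENNReal.ofReal (|r| ^ (-(1 / 2) : ℝ))

theorem measurable_rieszKernel : Measurable rieszKernel := by
  unfold rieszKernel; fun_prop

theorem rieszKernel_sub_comm (s t : ℝ) : rieszKernel (s - t) = rieszKernel (t - s) := by
  simp only [rieszKernel, abs_sub_comm]

theorem lintegral_rieszKernel_near {R : ℝ} (hR : 0 < R) (s : ℝ) :
    ∫⁻ t, (if |s - t| ≤ R then rieszKernel (s - t) else 0) =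
      ENNReal.ofReal (4 * R ^ (1 / 2 : ℝ)) := by
  rw [lintegral_sub_left_eq_self (fun r => if |r| ≤ R then rieszKernel r else 0) s]
  have := lintegral_comp_abs
    fun r => if r ≤ R then ENNReal.ofReal (r ^ (-(1 / 2) : ℝ)) else 0
  unfold rieszKernel
  rw [this]
  have h : ∫⁻ x in Set.Ioi (0 : ℝ), (if x ≤ R then ENNReal.ofReal (x ^ (-(1 / 2) : ℝ)) else 0)
      = ∫⁻ x in Set.Ioc 0 R, ENNReal.ofReal (x ^ (-(1 / 2) : ℝ)) := by
    rw [← Set.Ioi_inter_Iic, Set.inter_comm, ← setLIntegral_indicator measurableSet_Iic]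
    rfl
  rw [h, lintegral_Ioc_rpow_neg_half hR, show (2 : ℝ≥0∞) = ENNReal.ofReal 2 by simp,
    ← ENNReal.ofReal_mul (by norm_num)]
  congr 1
  ring

/-- The power `4` is the exponent conjugate to `4/3`; it turns the kernel into `|r|^{-2}`, which is
integrable away from the origin. -/
theorem lintegral_rieszKernel_far {R : ℝ} (hR : 0 < R) (s : ℝ) :
    ∫⁻ t, (if |s - t| ≤ R then 0 else rieszKernel (s - t)) ^ (4 : ℝ) =
      ENNReal.ofReal (2 * R⁻¹) := by
  rw [lintegral_sub_left_eq_self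
    (fun r => (if |r| ≤ R then 0 else rieszKernel r) ^ (4 : ℝ)) s]
  have := lintegral_comp_abs
    fun r => (if r ≤ R then 0 else ENNReal.ofReal (r ^ (-(1 / 2) : ℝ))) ^ (4 : ℝ)
  unfold rieszKernel
  rw [this]
  have h : ∫⁻ x in Set.Ioi (0 : ℝ),
        (if x ≤ R then 0 else ENNReal.ofReal (x ^ (-(1 / 2) : ℝ))) ^ (4 : ℝ)
      = ∫⁻ x in Set.Ioi R, ENNReal.ofReal (x ^ (-2 : ℝ)) := by
    rw [← Set.inter_eq_left.2 (Set.Ioi_subset_Ioi hR.le), ← setLIntegral_indicator measurableSet_Ioi]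
    refine setLIntegral_congr_fun measurableSet_Ioi fun x hx => ?_
    have hx0 : (0 : ℝ) < x := hx
    by_cases hxR : x ≤ R
    · simp [hxR]
    · rw [if_neg hxR, Set.indicator_of_mem (by simpa using hxR),
        ENNReal.ofReal_rpow_of_pos (Real.rpow_pos_of_pos hx0 _), ← Real.rpow_mul hx0.le]
      norm_num
  rw [h, lintegral_Ioi_rpow_neg_two hR, show (2 : ℝ≥0∞) = ENNReal.ofReal 2 by simp,
    ← ENNReal.ofReal_mul (by norm_num)]

/-- Pointwise bound for the fractional integral of a function truncated at height `a`. -/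
theorem lintegral_rieszKernel_mul_truncation_le {g : ℝ → ℝ≥0∞} (hg : Measurable g)
    (h0 : ∫⁻ t, g t ^ (4 / 3 : ℝ) ≠ 0) (htop : ∫⁻ t, g t ^ (4 / 3 : ℝ) ≠ ⊤) (a : ℝ≥0∞) (s : ℝ) :
    ∫⁻ t, rieszKernel (s - t) * (if g t ≤ a then g t else 0) ≤
      6 * (a ^ (1 / 3 : ℝ) * (∫⁻ t, g t ^ (4 / 3 : ℝ)) ^ (1 / 2 : ℝ)) := by
  set N := ∫⁻ t, g t ^ (4 / 3 : ℝ) with hN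
  rcases eq_or_ne a 0 with rfl | ha0
  · have : ∀ t, (if g t ≤ 0 then g t else 0) = 0 := fun t => by
      split_ifs with h
      · exact le_zero_iff.1 h
      · rfl
    simp only [this, mul_zero, lintegral_zero]
    exact zero_le
  rcases eq_or_ne a ⊤ with rfl | hatop
  · rw [ENNReal.top_rpow_of_pos (by norm_num), ENNReal.top_mul, ENNReal.mul_top (by norm_num)]
    · exact le_top
    · simp [ENNReal.rpow_eq_zero_iff, h0, htop]
  set α := a.toReal with hα
  set n := N.toReal with hn
  have hαp : 0 < α := ENNReal.toReal_pos ha0 hatop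
  have hnp : 0 < n := ENNReal.toReal_pos h0 htop
  have ea : a = ENNReal.ofReal α := (ENNReal.ofReal_toReal hatop).symm
  have en : N = ENNReal.ofReal n := (ENNReal.ofReal_toReal htop).symm
  -- This radius balances the two parts: near `s` the truncated function is at most `a`, giving `4 a
  -- R^{1/2}`, while far from `s` Hölder with exponents `4/3` and `4` gives `N^{3/4} (2/R)^{1/4}`.
  set R := n * α ^ (-(4 / 3) : ℝ) with hR
  have hRp : 0 < R := by positivity
  have hk : Measurable fun t => rieszKernel (s - t) :=
    measurable_rieszKernel.comp (measurable_const.sub measurable_id)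
  have hset : MeasurableSet {t : ℝ | |s - t| ≤ R} :=
    measurableSet_le (by fun_prop) measurable_const
  have hnear : Measurable fun t => if |s - t| ≤ R then rieszKernel (s - t) else 0 :=
    Measurable.ite hset hk measurable_const
  have hfar : Measurable fun t => if |s - t| ≤ R then 0 else rieszKernel (s - t) :=
    Measurable.ite hset measurable_const hk
  have near : a * ∫⁻ t, (if |s - t| ≤ R then rieszKernel (s - t) else 0) =
      4 * (a ^ (1 / 3 : ℝ) * N ^ (1 / 2 : ℝ)) := by
    rw [lintegral_rieszKernel_near hRp, ea, en, ENNReal.ofReal_rpow_of_pos hαp,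
      ENNReal.ofReal_rpow_of_pos hnp, show (4 : ℝ≥0∞) = ENNReal.ofReal 4 by simp,
      ← ENNReal.ofReal_mul (by positivity), ← ENNReal.ofReal_mul (by positivity),
      ← ENNReal.ofReal_mul (by positivity)]
    congr 1
    rw [hR, Real.mul_rpow hnp.le (by positivity), ← Real.rpow_mul hαp.le,
      show (1 / 3 : ℝ) = 1 + -(4 / 3) * (1 / 2) by norm_num, Real.rpow_add hαp, Real.rpow_one]
    ring
  have far : N ^ (3 / 4 : ℝ) *
      (∫⁻ t, (if |s - t| ≤ R then 0 else rieszKernel (s - t)) ^ (4 : ℝ)) ^ (1 / 4 : ℝ) ≤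
      2 * (a ^ (1 / 3 : ℝ) * N ^ (1 / 2 : ℝ)) := by
    rw [lintegral_rieszKernel_far hRp, ea, en, ENNReal.ofReal_rpow_of_pos hαp,
      ENNReal.ofReal_rpow_of_pos hnp, ENNReal.ofReal_rpow_of_pos hnp,
      ENNReal.ofReal_rpow_of_pos (by positivity), show (2 : ℝ≥0∞) = ENNReal.ofReal 2 by simp,
      ← ENNReal.ofReal_mul (by positivity), ← ENNReal.ofReal_mul (by positivity),
      ← ENNReal.ofReal_mul (by positivity)]
    apply ENNReal.ofReal_le_ofReal
    have h2 : (2 : ℝ) ^ (1 / 4 : ℝ) ≤ 2 :=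
      (Real.rpow_le_rpow_of_exponent_le (by norm_num) (by norm_num)).trans_eq (Real.rpow_one 2)
    have e : n ^ (3 / 4 : ℝ) * (2 * R⁻¹) ^ (1 / 4 : ℝ) =
        2 ^ (1 / 4 : ℝ) * (α ^ (1 / 3 : ℝ) * n ^ (1 / 2 : ℝ)) := by
      rw [Real.mul_rpow (by norm_num) (by positivity), hR, mul_inv, ← Real.rpow_neg hαp.le,
        ← Real.rpow_neg_one n, Real.mul_rpow (by positivity) (by positivity),
        ← Real.rpow_mul hαp.le, ← Real.rpow_mul hnp.le,
        show (1 / 2 : ℝ) = 3 / 4 + -1 * (1 / 4) by norm_num, Real.rpow_add hnp]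
      norm_num
      ring
    rw [e]
    gcongr
  calc ∫⁻ t, rieszKernel (s - t) * (if g t ≤ a then g t else 0)
      ≤ ∫⁻ t, (a * (if |s - t| ≤ R then rieszKernel (s - t) else 0) +
          g t * (if |s - t| ≤ R then 0 else rieszKernel (s - t))) := by
        refine lintegral_mono fun t => ?_
        dsimp only
        split_ifs with h1 h2 h2
        · rw [mul_zero, add_zero, mul_comm]; gcongr
        · rw [mul_zero, zero_add, mul_comm]
        · simp
        · simp
    _ = (a * ∫⁻ t, (if |s - t| ≤ R then rieszKernel (s - t) else 0)) +
          ∫⁻ t, g t * (if |s - t| ≤ R then 0 else rieszKernel (s - t)) := by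
        rw [lintegral_add_left (hnear.const_mul a), lintegral_const_mul _ hnear]
    _ ≤ 4 * (a ^ (1 / 3 : ℝ) * N ^ (1 / 2 : ℝ)) + 2 * (a ^ (1 / 3 : ℝ) * N ^ (1 / 2 : ℝ)) := by
        refine add_le_add near.le (le_trans ?_ far)
        have hpq : (4 / 3 : ℝ).HolderConjugate 4 :=
          (Real.holderConjugate_iff).2 ⟨by norm_num, by norm_num⟩
        have := ENNReal.lintegral_mul_le_Lp_mul_Lq volume hpq hg.aemeasurable hfar.aemeasurable
        rw [show (1 / (4 / 3) : ℝ) = 3 / 4 by norm_num] at this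
        exact this
    _ = _ := by rw [← add_mul]; norm_num

/-- The one-dimensional Hardy–Littlewood–Sobolev inequality for the kernel `|s - t|^{-1/2}`. -/
theorem hardyLittlewoodSobolev_half {g : ℝ → ℝ≥0∞} (hg : Measurable g) :
    ∫⁻ s, ∫⁻ t, rieszKernel (s - t) * (g s * g t) ≤
      12 * (∫⁻ t, g t ^ (4 / 3 : ℝ)) ^ (3 / 2 : ℝ) := by
  set N := ∫⁻ t, g t ^ (4 / 3 : ℝ) with hN
  rcases eq_or_ne N 0 with h0 | h0
  · have hae : ∀ᵐ t, g t = 0 := by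
      have := (lintegral_eq_zero_iff (hg.pow_const _)).1 (hN ▸ h0)
      filter_upwards [this] with t ht
      exact (ENNReal.rpow_eq_zero_iff_of_pos (by norm_num)).1 ht
    have : ∫⁻ s, ∫⁻ t, rieszKernel (s - t) * (g s * g t) = 0 := by
      rw [← lintegral_zero (μ := (volume : Measure ℝ))]
      refine lintegral_congr fun s => ?_
      rw [← lintegral_zero (μ := (volume : Measure ℝ))]
      refine lintegral_congr_ae ?_
      filter_upwards [hae] with t ht
      simp [ht]
    rw [this]
    exact zero_le
  rcases eq_or_ne N ⊤ with htop | htop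
  · rw [htop, ENNReal.top_rpow_of_pos (by norm_num), ENNReal.mul_top (by norm_num)]
    exact le_top
  -- The double integral is split according to which of `g s`, `g t` is larger. Truncating at the
  -- height `g s` yields `g s * g s ^ (1/3) = g s ^ (4/3)`, so the strong type bound follows from
  -- the pointwise one without interpolation.
  set T : ℝ → ℝ → ℝ≥0∞ :=
    fun s t => g s * (rieszKernel (s - t) * (if g t ≤ g s then g t else 0)) with hT
  have hg1 : Measurable fun p : ℝ × ℝ => g p.1 := hg.comp measurable_fst
  have hg2 : Measurable fun p : ℝ × ℝ => g p.2 := hg.comp measurable_snd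
  have hTm : Measurable (Function.uncurry T) :=
    hg1.mul ((measurable_rieszKernel.comp (measurable_fst.sub measurable_snd)).mul
      (Measurable.ite (measurableSet_le hg2 hg1) hg2 measurable_const))
  have hTint : ∫⁻ s, ∫⁻ t, T s t ≤ 6 * N ^ (3 / 2 : ℝ) := by
    calc ∫⁻ s, ∫⁻ t, T s t
        ≤ ∫⁻ s, 6 * N ^ (1 / 2 : ℝ) * g s ^ (4 / 3 : ℝ) := by
          refine lintegral_mono fun s => ?_
          have hm : Measurable fun t => rieszKernel (s - t) * (if g t ≤ g s then g t else 0) :=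
            (measurable_rieszKernel.comp (measurable_const.sub measurable_id)).mul
              (Measurable.ite (measurableSet_le hg measurable_const) hg measurable_const)
          simp only [hT]
          rw [lintegral_const_mul _ hm]
          refine (mul_le_mul_right
            (lintegral_rieszKernel_mul_truncation_le hg h0 htop (g s) s) _).trans_eq ?_
          rw [show (4 / 3 : ℝ) = 1 + 1 / 3 by norm_num,
            ENNReal.rpow_add_of_nonneg _ _ (by norm_num) (by norm_num), ENNReal.rpow_one]
          rw [hN, show (4 / 3 : ℝ) = 1 + 1 / 3 by norm_num]
          ring
      _ = 6 * (N ^ (1 / 2 : ℝ) * N) := by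
          rw [lintegral_const_mul _ (hg.pow_const _), mul_assoc]
      _ = 6 * N ^ (3 / 2 : ℝ) := by
          rw [show (3 / 2 : ℝ) = 1 / 2 + 1 by norm_num,
            ENNReal.rpow_add_of_nonneg _ _ (by norm_num) (by norm_num), ENNReal.rpow_one]
  calc ∫⁻ s, ∫⁻ t, rieszKernel (s - t) * (g s * g t)
      ≤ ∫⁻ s, ∫⁻ t, (T s t + T t s) := by
        refine lintegral_mono fun s => lintegral_mono fun t => ?_
        rcases le_total (g t) (g s) with h | h
        · refine le_trans (le_of_eq ?_) le_self_add
          simp only [hT, if_pos h]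
          ring
        · refine le_trans (le_of_eq ?_) le_add_self
          simp only [hT, if_pos h]
          rw [rieszKernel_sub_comm]
          ring
    _ = (∫⁻ s, ∫⁻ t, T s t) + ∫⁻ s, ∫⁻ t, T t s := by
        have hTi : Measurable fun s => ∫⁻ t, T s t := hTm.lintegral_prod_right'
        rw [← lintegral_add_left hTi]
        refine lintegral_congr fun s => ?_
        exact lintegral_add_left (hTm.comp (measurable_const.prodMk measurable_id)) _
    _ ≤ 6 * N ^ (3 / 2 : ℝ) + 6 * N ^ (3 / 2 : ℝ) := by
        refine add_le_add hTint ?_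
        rw [lintegral_lintegral_swap (f := fun s t => T t s)
          (hTm.comp (measurable_snd.prodMk measurable_fst)).aemeasurable]
        exact hTint
    _ = _ := by rw [← add_mul]; norm_num

/-! ### One-dimensional oscillatory integrals. -/

/-- One integration by parts: `θ₁ e^{iλθ}` is the derivative of `e^{iλθ} / (iλ)`, and the boundary
terms vanish. The factor `θ₁` is kept explicit so that the identity can be iterated. -/
theorem integral_exp_phase_mul {p q lam : ℝ} (hlam : lam ≠ 0) (hpq : p ≤ q) {θ θ₁ : ℝ → ℝ}
    {v v₁ : ℝ → ℂ} (hθ : ∀ x ∈ Set.Icc p q, HasDerivAt θ (θ₁ x) x)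
    (hv : ∀ x ∈ Set.Icc p q, HasDerivAt v (v₁ x) x) (hθc : ContinuousOn θ₁ (Set.Icc p q))
    (hvc : ContinuousOn v₁ (Set.Icc p q)) (hp : v p = 0) (hq : v q = 0) :
    ∫ x in p..q, Complex.exp (Complex.I * ((lam * θ x : ℝ) : ℂ)) * (θ₁ x * v x) =
      Complex.I / lam * ∫ x in p..q, Complex.exp (Complex.I * ((lam * θ x : ℝ) : ℂ)) * v₁ x := by
  have hlam' : (lam : ℂ) ≠ 0 := by exact_mod_cast hlam
  rw [← Set.uIcc_of_le hpq] at *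
  have he : ∀ x ∈ Set.uIcc p q,
      HasDerivAt (fun x => Complex.exp (Complex.I * ((lam * θ x : ℝ) : ℂ)))
        (Complex.exp (Complex.I * ((lam * θ x : ℝ) : ℂ)) *
          (Complex.I * ((lam * θ₁ x : ℝ) : ℂ))) x := fun x hx =>
    ((((hθ x hx).const_mul lam).ofReal_comp).const_mul Complex.I).cexp
  have hec : ContinuousOn (fun x => Complex.exp (Complex.I * ((lam * θ x : ℝ) : ℂ)))
      (Set.uIcc p q) := fun x hx => (he x hx).continuousAt.continuousWithinAt
  have hec' : ContinuousOn (fun x => Complex.exp (Complex.I * ((lam * θ x : ℝ) : ℂ)) *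
      (Complex.I * ((lam * θ₁ x : ℝ) : ℂ))) (Set.uIcc p q) :=
    hec.mul (continuousOn_const.mul (Complex.continuous_ofReal.comp_continuousOn
      (continuousOn_const.mul hθc)))
  have key := intervalIntegral.integral_mul_deriv_eq_deriv_mul he hv hec'.intervalIntegrable
    hvc.intervalIntegrable
  rw [hp, hq] at key
  rw [key, mul_zero, mul_zero, sub_zero, zero_sub, mul_neg, ← intervalIntegral.integral_const_mul,
    ← intervalIntegral.integral_neg]
  refine intervalIntegral.integral_congr fun x _ => ?_
  push_cast
  field_simp
  linear_combination (θ₁ x * v x) * Complex.I_sq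

/-- Second order van der Corput estimate with amplitude, by two integrations by parts. -/
theorem norm_integral_exp_phase_mul_le {p q lam m b A B : ℝ} (hlam : lam ≠ 0) (hpq : p ≤ q)
    (hm : 0 < m) (hb : 0 < b) (hA : 0 ≤ A) (hB : 0 ≤ B) (hlen : q - p ≤ b)
    {θ θ₁ θ₂ θ₃ : ℝ → ℝ} {a a₁ a₂ : ℝ → ℂ}
    (hθ : ∀ x ∈ Set.Icc p q, HasDerivAt θ (θ₁ x) x)
    (hθ₁ : ∀ x ∈ Set.Icc p q, HasDerivAt θ₁ (θ₂ x) x)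
    (hθ₂ : ∀ x ∈ Set.Icc p q, HasDerivAt θ₂ (θ₃ x) x)
    (hθ₃ : ContinuousOn θ₃ (Set.Icc p q))
    (ha : ∀ x ∈ Set.Icc p q, HasDerivAt a (a₁ x) x)
    (ha₁ : ∀ x ∈ Set.Icc p q, HasDerivAt a₁ (a₂ x) x)
    (ha₂ : ContinuousOn a₂ (Set.Icc p q))
    (bθ₁ : ∀ x ∈ Set.Icc p q, m ≤ |θ₁ x|) (bθ₂ : ∀ x ∈ Set.Icc p q, |θ₂ x| ≤ B * m * b⁻¹)
    (bθ₃ : ∀ x ∈ Set.Icc p q, |θ₃ x| ≤ B * m * (b ^ 2)⁻¹)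
    (ba : ∀ x ∈ Set.Icc p q, ‖a x‖ ≤ A) (ba₁ : ∀ x ∈ Set.Icc p q, ‖a₁ x‖ ≤ A * b⁻¹)
    (ba₂ : ∀ x ∈ Set.Icc p q, ‖a₂ x‖ ≤ A * (b ^ 2)⁻¹)
    (hap : a p = 0) (haq : a q = 0) (ha₁p : a₁ p = 0) (ha₁q : a₁ q = 0) :
    ‖∫ x in p..q, Complex.exp (Complex.I * ((lam * θ x : ℝ) : ℂ)) * a x‖ ≤
      A * (1 + 4 * B + 3 * B ^ 2) * b / (|lam| * m * b) ^ 2 := by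
  have hne : ∀ x ∈ Set.Icc p q, (θ₁ x : ℂ) ≠ 0 := fun x hx => by
    have := abs_pos.1 (hm.trans_le (bθ₁ x hx))
    exact_mod_cast this
  have cθ₁ : ContinuousOn θ₁ (Set.Icc p q) := fun x hx =>
    (hθ₁ x hx).continuousAt.continuousWithinAt
  have cθ₂ : ContinuousOn θ₂ (Set.Icc p q) := fun x hx =>
    (hθ₂ x hx).continuousAt.continuousWithinAt
  have ca : ContinuousOn a (Set.Icc p q) := fun x hx =>
    (ha x hx).continuousAt.continuousWithinAt
  have ca₁ : ContinuousOn a₁ (Set.Icc p q) := fun x hx =>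
    (ha₁ x hx).continuousAt.continuousWithinAt
  have cc : ∀ {f : ℝ → ℝ}, ContinuousOn f (Set.Icc p q) →
      ContinuousOn (fun x => (f x : ℂ)) (Set.Icc p q) := fun hf =>
    Complex.continuous_ofReal.comp_continuousOn hf
  have cθ₁' := cc cθ₁
  have cθ₂' := cc cθ₂
  have cθ₃' := cc hθ₃
  -- Each integration by parts divides by `θ₁` and differentiates: `v = a / θ₁`, `v₁ = v'`, `w = v₁
  -- / θ₁`, `w₁ = w'`. Two rounds replace the amplitude `a` by `w₁` at the price of `(i/λ)²`.
  set v : ℝ → ℂ := fun x => a x / θ₁ x with hv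
  set v₁ : ℝ → ℂ := fun x => (a₁ x * θ₁ x - a x * θ₂ x) / (θ₁ x : ℂ) ^ 2 with hv₁
  set w : ℝ → ℂ := fun x => (a₁ x * θ₁ x - a x * θ₂ x) / (θ₁ x : ℂ) ^ 3 with hw
  set w₁ : ℝ → ℂ := fun x => a₂ x / (θ₁ x : ℂ) ^ 2 - 3 * a₁ x * θ₂ x / (θ₁ x : ℂ) ^ 3
    - a x * θ₃ x / (θ₁ x : ℂ) ^ 3 + 3 * a x * (θ₂ x : ℂ) ^ 2 / (θ₁ x : ℂ) ^ 4 with hw₁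
  have dv : ∀ x ∈ Set.Icc p q, HasDerivAt v (v₁ x) x := fun x hx =>
    (ha x hx).div (hθ₁ x hx).ofReal_comp (hne x hx)
  have dw : ∀ x ∈ Set.Icc p q, HasDerivAt w (w₁ x) x := fun x hx => by
    have hx0 := hne x hx
    refine ((((ha₁ x hx).mul (hθ₁ x hx).ofReal_comp).sub
      ((ha x hx).mul (hθ₂ x hx).ofReal_comp)).div ((hθ₁ x hx).ofReal_comp.pow 3)
      (pow_ne_zero 3 hx0)).congr_deriv ?_
    simp only [hw₁, Pi.mul_apply, Pi.sub_apply, Pi.pow_apply]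
    field_simp
    ring
  have cv₁ : ContinuousOn v₁ (Set.Icc p q) :=
    ((ca₁.mul cθ₁').sub (ca.mul cθ₂')).div (cθ₁'.pow 2) fun x hx => pow_ne_zero 2 (hne x hx)
  have cw₁ : ContinuousOn w₁ (Set.Icc p q) := by
    refine (((ha₂.div (cθ₁'.pow 2) ?_).sub (((continuousOn_const.mul ca₁).mul cθ₂').div
      (cθ₁'.pow 3) ?_)).sub ((ca.mul cθ₃').div (cθ₁'.pow 3) ?_)).add
      (((continuousOn_const.mul ca).mul (cθ₂'.pow 2)).div (cθ₁'.pow 4) ?_) <;>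
    exact fun x hx => pow_ne_zero _ (hne x hx)
  have s1 := integral_exp_phase_mul hlam hpq hθ dv cθ₁ cv₁ (by simp [hv, hap]) (by simp [hv, haq])
  have s2 := integral_exp_phase_mul hlam hpq hθ dw cθ₁ cw₁ (by simp [hw, hap, ha₁p])
    (by simp [hw, haq, ha₁q])
  have e1 : ∫ x in p..q, Complex.exp (Complex.I * ((lam * θ x : ℝ) : ℂ)) * a x =
      ∫ x in p..q, Complex.exp (Complex.I * ((lam * θ x : ℝ) : ℂ)) * (θ₁ x * v x) :=
    intervalIntegral.integral_congr fun x hx => by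
      have := hne x (Set.uIcc_of_le hpq ▸ hx)
      simp only [hv]
      field_simp
  have e2 : ∫ x in p..q, Complex.exp (Complex.I * ((lam * θ x : ℝ) : ℂ)) * v₁ x =
      ∫ x in p..q, Complex.exp (Complex.I * ((lam * θ x : ℝ) : ℂ)) * (θ₁ x * w x) :=
    intervalIntegral.integral_congr fun x hx => by
      have := hne x (Set.uIcc_of_le hpq ▸ hx)
      simp only [hv₁, hw]
      field_simp
  -- All four terms of `w₁` scale like `A / (m b)²`; their coefficients `1`, `3B`, `B` and `3B²` add
  -- up to the constant.
  have bw : ∀ x ∈ Set.Icc p q, ‖w₁ x‖ ≤ A * (1 + 4 * B + 3 * B ^ 2) / (m * b) ^ 2 := fun x hx => by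
    have h1 := bθ₁ x hx
    have hθp : 0 < |θ₁ x| := hm.trans_le h1
    have t1 : ‖a₂ x / (θ₁ x : ℂ) ^ 2‖ ≤ A * (b ^ 2)⁻¹ / m ^ 2 := by
      rw [norm_div, norm_pow, Complex.norm_real, Real.norm_eq_abs]
      gcongr
      exact ba₂ x hx
    have t2 : ‖3 * a₁ x * θ₂ x / (θ₁ x : ℂ) ^ 3‖ ≤
        3 * (A * b⁻¹) * (B * m * b⁻¹) / m ^ 3 := by
      rw [norm_div, norm_pow, norm_mul, norm_mul, Complex.norm_real, Complex.norm_real,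
        Real.norm_eq_abs, Real.norm_eq_abs, Complex.norm_ofNat]
      gcongr
      exacts [ba₁ x hx, bθ₂ x hx]
    have t3 : ‖a x * θ₃ x / (θ₁ x : ℂ) ^ 3‖ ≤ A * (B * m * (b ^ 2)⁻¹) / m ^ 3 := by
      rw [norm_div, norm_pow, norm_mul, Complex.norm_real, Complex.norm_real,
        Real.norm_eq_abs, Real.norm_eq_abs]
      gcongr
      exacts [ba x hx, bθ₃ x hx]
    have t4 : ‖3 * a x * (θ₂ x : ℂ) ^ 2 / (θ₁ x : ℂ) ^ 4‖ ≤
        3 * A * (B * m * b⁻¹) ^ 2 / m ^ 4 := by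
      rw [norm_div, norm_pow, norm_mul, norm_mul, norm_pow, Complex.norm_real, Complex.norm_real,
        Real.norm_eq_abs, Real.norm_eq_abs, Complex.norm_ofNat]
      gcongr
      exacts [ba x hx, bθ₂ x hx]
    calc ‖w₁ x‖ ≤ _ := (norm_add_le _ _).trans (add_le_add_left ((norm_sub_le _ _).trans
          (add_le_add_left (norm_sub_le _ _) _)) _)
      _ ≤ A * (b ^ 2)⁻¹ / m ^ 2 + 3 * (A * b⁻¹) * (B * m * b⁻¹) / m ^ 3
          + A * (B * m * (b ^ 2)⁻¹) / m ^ 3 + 3 * A * (B * m * b⁻¹) ^ 2 / m ^ 4 :=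
          add_le_add (add_le_add (add_le_add t1 t2) t3) t4
      _ = _ := by field_simp; ring
  have hfin : ‖∫ x in p..q, Complex.exp (Complex.I * ((lam * θ x : ℝ) : ℂ)) * w₁ x‖ ≤
      A * (1 + 4 * B + 3 * B ^ 2) / (m * b) ^ 2 * b := by
    refine (intervalIntegral.norm_integral_le_of_norm_le_const fun x hx => ?_).trans
      (mul_le_mul_of_nonneg_left ?_ (by positivity))
    · rw [norm_mul, mul_comm Complex.I, Complex.norm_exp_ofReal_mul_I, one_mul]
      exact bw x (Set.Ioc_subset_Icc_self (Set.uIoc_of_le hpq ▸ hx))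
    · rwa [abs_of_nonneg (sub_nonneg.2 hpq)]
  rw [e1, s1, e2, s2, norm_mul, norm_mul, norm_div, Complex.norm_I, Complex.norm_real,
    Real.norm_eq_abs]
  have hl : 0 < |lam| := abs_pos.2 hlam
  calc _ ≤ 1 / |lam| * (1 / |lam| * (A * (1 + 4 * B + 3 * B ^ 2) / (m * b) ^ 2 * b)) := by gcongr
    _ = _ := by field_simp

/-! ### Amplitudes adapted to a length scale, and boundary values. -/

/-- `f` is twice continuously differentiable, with bounds adapted to the length scale `b`. -/
structure ScaledC2Bound (f : ℝ → ℂ) (A b : ℝ) : Prop where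
  contDiff : ContDiff ℝ 2 f
  bound : ∀ x, ‖f x‖ ≤ A
  bound_deriv : ∀ x, ‖deriv f x‖ ≤ A * b⁻¹
  bound_deriv2 : ∀ x, ‖deriv (deriv f) x‖ ≤ A * (b ^ 2)⁻¹

namespace ScaledC2Bound

variable {f g : ℝ → ℂ} {A B b : ℝ}

theorem nonneg (hf : ScaledC2Bound f A b) : 0 ≤ A := (norm_nonneg _).trans (hf.bound 0)

theorem hasDerivAt (hf : ScaledC2Bound f A b) (x : ℝ) : HasDerivAt f (deriv f x) x :=
  (hf.contDiff.differentiable (by norm_num) x).hasDerivAt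

theorem contDiff_deriv (hf : ScaledC2Bound f A b) : ContDiff ℝ 1 (deriv f) :=
  ((contDiff_succ_iff_deriv (n := 1)).1 (by rw [one_add_one_eq_two]; exact hf.contDiff)).2.2

theorem hasDerivAt_deriv (hf : ScaledC2Bound f A b) (x : ℝ) :
    HasDerivAt (deriv f) (deriv (deriv f) x) x :=
  (hf.contDiff_deriv.differentiable (by norm_num) x).hasDerivAt

theorem continuous_deriv2 (hf : ScaledC2Bound f A b) : Continuous (deriv (deriv f)) :=
  hf.contDiff_deriv.continuous_deriv (by norm_num)

theorem conj (hf : ScaledC2Bound f A b) :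
    ScaledC2Bound (fun x => (starRingEnd ℂ) (f x)) A b := by
  have h1 : deriv (fun x => (starRingEnd ℂ) (f x)) = fun x => (starRingEnd ℂ) (deriv f x) :=
    funext fun x => (hf.hasDerivAt x).star.deriv
  have h2 : deriv (fun x => (starRingEnd ℂ) (deriv f x)) =
      fun x => (starRingEnd ℂ) (deriv (deriv f) x) :=
    funext fun x => (hf.hasDerivAt_deriv x).star.deriv
  refine ⟨Complex.conjCLE.contDiff.comp hf.contDiff, fun x => ?_, fun x => ?_, fun x => ?_⟩
  · rw [RCLike.norm_conj]; exact hf.bound x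
  · rw [h1, RCLike.norm_conj]; exact hf.bound_deriv x
  · rw [h1, h2, RCLike.norm_conj]; exact hf.bound_deriv2 x

/-- The factor `4` counts the terms of the second derivative of a product, with multiplicity. -/
theorem mul (hb : 0 < b) (hf : ScaledC2Bound f A b) (hg : ScaledC2Bound g B b) :
    ScaledC2Bound (fun x => f x * g x) (4 * (A * B)) b := by
  have h1 : deriv (fun x => f x * g x) = fun x => deriv f x * g x + f x * deriv g x :=
    funext fun x => ((hf.hasDerivAt x).mul (hg.hasDerivAt x)).deriv
  have h2 : deriv (fun x => deriv f x * g x + f x * deriv g x) = fun x =>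
      (deriv (deriv f) x * g x + deriv f x * deriv g x) +
        (deriv f x * deriv g x + f x * deriv (deriv g) x) :=
    funext fun x => (((hf.hasDerivAt_deriv x).mul (hg.hasDerivAt x)).add
      ((hf.hasDerivAt x).mul (hg.hasDerivAt_deriv x))).deriv
  have hA := hf.nonneg
  have hB := hg.nonneg
  have hbi : 0 < b⁻¹ := inv_pos.2 hb
  have key : ∀ {z w : ℂ} {c d : ℝ}, ‖z‖ ≤ c → ‖w‖ ≤ d → ‖z * w‖ ≤ c * d := fun hz hw => by
    rw [norm_mul]
    exact mul_le_mul hz hw (norm_nonneg _) ((norm_nonneg _).trans hz)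
  have hAB : 0 ≤ A * B := by positivity
  refine ⟨hf.contDiff.mul hg.contDiff, fun x => ?_, fun x => ?_, fun x => ?_⟩
  · exact (key (hf.bound x) (hg.bound x)).trans (by linarith)
  · rw [h1]
    refine (norm_add_le_of_le (key (hf.bound_deriv x) (hg.bound x))
      (key (hf.bound x) (hg.bound_deriv x))).trans ?_
    have : 0 ≤ A * B * b⁻¹ := by positivity
    linarith
  · rw [h1, h2]
    refine (norm_add_le_of_le
      (norm_add_le_of_le (key (hf.bound_deriv2 x) (hg.bound x))
        (key (hf.bound_deriv x) (hg.bound_deriv x)))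
      (norm_add_le_of_le (key (hf.bound_deriv x) (hg.bound_deriv x))
        (key (hf.bound x) (hg.bound_deriv2 x)))).trans (le_of_eq ?_)
    ring

end ScaledC2Bound

/-- Used, with the three lemmas below, to make the amplitude and its first derivative vanish at the
endpoints, as the two integrations by parts require. -/
theorem eq_zero_of_Iio {f : ℝ → ℂ} (hf : Continuous f) {p : ℝ} (h : ∀ x < p, f x = 0) :
    f p = 0 := by
  have hc : IsClosed {x | f x = 0} := isClosed_eq hf continuous_const
  have : closure (Set.Iio p) ⊆ {x | f x = 0} := closure_minimal h hc
  rw [closure_Iio] at this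
  exact this (Set.mem_Iic.2 le_rfl)

theorem eq_zero_of_Ioi {f : ℝ → ℂ} (hf : Continuous f) {p : ℝ} (h : ∀ x, p < x → f x = 0) :
    f p = 0 := by
  have hc : IsClosed {x | f x = 0} := isClosed_eq hf continuous_const
  have : closure (Set.Ioi p) ⊆ {x | f x = 0} := closure_minimal h hc
  rw [closure_Ioi] at this
  exact this (Set.mem_Ici.2 le_rfl)

theorem deriv_eq_zero_of_Iio {f : ℝ → ℂ} {p : ℝ} (h : ∀ x < p, f x = 0) (x : ℝ) (hx : x < p) :
    deriv f x = 0 := by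
  have : f =ᶠ[nhds x] fun _ => 0 := by
    filter_upwards [Iio_mem_nhds hx] with y hy using h y hy
  rw [this.deriv_eq, deriv_const]

theorem deriv_eq_zero_of_Ioi {f : ℝ → ℂ} {p : ℝ} (h : ∀ x, p < x → f x = 0) (x : ℝ)
    (hx : p < x) : deriv f x = 0 := by
  have : f =ᶠ[nhds x] fun _ => 0 := by
    filter_upwards [Ioi_mem_nhds hx] with y hy using h y hy
  rw [this.deriv_eq, deriv_const]

/-- The mean value theorem without an order on the endpoints: the parameters `y, z` and `s, t` come
in any order and may coincide. -/
theorem exists_hasDerivAt_sub_eq_mul {f f' : ℝ → ℝ} {a b : ℝ}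
    (hf : ∀ x ∈ Set.uIcc a b, HasDerivAt f (f' x) x) :
    ∃ c ∈ Set.uIcc a b, f b - f a = (b - a) * f' c := by
  rcases lt_trichotomy a b with h | rfl | h
  · rw [Set.uIcc_of_le h.le] at *
    obtain ⟨c, hc, e⟩ := exists_hasDerivAt_eq_slope f f' h
      (fun x hx => (hf x hx).continuousAt.continuousWithinAt)
      (fun x hx => hf x (Set.Ioo_subset_Icc_self hx))
    refine ⟨c, Set.Ioo_subset_Icc_self hc, ?_⟩
    rw [e, mul_div_cancel₀ _ (sub_ne_zero.2 h.ne')]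
  · exact ⟨a, Set.left_mem_uIcc, by simp⟩
  · rw [Set.uIcc_of_ge h.le] at *
    obtain ⟨c, hc, e⟩ := exists_hasDerivAt_eq_slope f f' h
      (fun x hx => (hf x hx).continuousAt.continuousWithinAt)
      (fun x hx => hf x (Set.Ioo_subset_Icc_self hx))
    refine ⟨c, Set.Ioo_subset_Icc_self hc, ?_⟩
    have : a - b ≠ 0 := sub_ne_zero.2 h.ne'
    rw [e]
    field_simp
    ring

/-! ### Commuting partial derivatives of analytic functions. -/

theorem AnalyticAt.partialDeriv {F : R3 → ℝ} {x : R3} (hF : AnalyticAt ℝ F x) (j : Fin 3) :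
    AnalyticAt ℝ (partialDeriv j F) x :=
  ((ContinuousLinearMap.apply ℝ ℝ (basisVec j)).analyticAt _).comp hF.fderiv

theorem partialDeriv_congr {F G : R3 → ℝ} {x : R3} (h : F =ᶠ[nhds x] G) (j : Fin 3) :
    partialDeriv j F =ᶠ[nhds x] partialDeriv j G := by
  filter_upwards [h.fderiv (𝕜 := ℝ)] with y hy
  simp only [partialDeriv, hy]

/-- Equality near the point, rather than at it, allows both sides to be differentiated again. -/
theorem partialDeriv_comm {F : R3 → ℝ} {x : R3} (hF : AnalyticAt ℝ F x) (i j : Fin 3) :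
    partialDeriv i (partialDeriv j F) =ᶠ[nhds x] partialDeriv j (partialDeriv i F) := by
  filter_upwards [hF.eventually_analyticAt] with y hy
  have hd : DifferentiableAt ℝ (fderiv ℝ F) y := hy.fderiv.differentiableAt
  have key : ∀ k l : Fin 3, partialDeriv k (partialDeriv l F) y =
      fderiv ℝ (fderiv ℝ F) y (basisVec k) (basisVec l) := fun k l => by
    change fderiv ℝ (fun z => fderiv ℝ F z (basisVec l)) y (basisVec k) = _
    rw [fderiv_clm_apply hd (differentiableAt_const _)]
    simp
  rw [key, key]
  exact (hy.contDiffAt (n := ω)).isSymmSndFDerivAt (by simp) _ _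

/-- The order of differentiation on the left is the one that arises from differentiating the phase
in `x₁` and then applying the mean value theorem in `x₂` and `x₃`. -/
theorem partialDeriv_two_one_zero {F : R3 → ℝ} {x : R3} (hF : AnalyticAt ℝ F x) :
    partialDeriv 2 (partialDeriv 1 (partialDeriv 0 F)) =ᶠ[nhds x] D3 F :=
  calc partialDeriv 2 (partialDeriv 1 (partialDeriv 0 F))
      =ᶠ[nhds x] partialDeriv 2 (partialDeriv 0 (partialDeriv 1 F)) :=
        partialDeriv_congr (partialDeriv_comm hF 1 0) 2
    _ =ᶠ[nhds x] partialDeriv 0 (partialDeriv 2 (partialDeriv 1 F)) :=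
        partialDeriv_comm (hF.partialDeriv 1) 2 0
    _ =ᶠ[nhds x] D3 F := partialDeriv_congr (partialDeriv_comm hF 2 1) 0

theorem D3_partialDeriv_zero {F : R3 → ℝ} {x : R3} (hF : AnalyticAt ℝ F x) :
    D3 (partialDeriv 0 F) =ᶠ[nhds x] partialDeriv 0 (D3 F) := by
  have h : partialDeriv 1 (partialDeriv 2 (partialDeriv 0 F)) =ᶠ[nhds x]
      partialDeriv 0 (partialDeriv 1 (partialDeriv 2 F)) :=
    (partialDeriv_congr (partialDeriv_comm hF 2 0) 1).trans
      (partialDeriv_comm (hF.partialDeriv 2) 1 0)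
  exact partialDeriv_congr h 0

theorem hasDerivAt_slice_zero {E : Type*} [NormedAddCommGroup E] [NormedSpace ℝ E] {F : R3 → E}
    {x y z : ℝ} (hF : DifferentiableAt ℝ F (x, y, z)) :
    HasDerivAt (fun t => F (t, y, z)) (partialDeriv 0 F (x, y, z)) x :=
  hF.hasFDerivAt.comp_hasDerivAt x
    ((hasDerivAt_id x).prodMk ((hasDerivAt_const x y).prodMk (hasDerivAt_const x z)))

theorem hasDerivAt_slice_one {E : Type*} [NormedAddCommGroup E] [NormedSpace ℝ E] {F : R3 → E}
    {x y z : ℝ} (hF : DifferentiableAt ℝ F (x, y, z)) :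
    HasDerivAt (fun t => F (x, t, z)) (partialDeriv 1 F (x, y, z)) y :=
  hF.hasFDerivAt.comp_hasDerivAt y
    ((hasDerivAt_const y x).prodMk ((hasDerivAt_id y).prodMk (hasDerivAt_const y z)))

theorem hasDerivAt_slice_two {E : Type*} [NormedAddCommGroup E] [NormedSpace ℝ E] {F : R3 → E}
    {x y z : ℝ} (hF : DifferentiableAt ℝ F (x, y, z)) :
    HasDerivAt (fun t => F (x, y, t)) (partialDeriv 2 F (x, y, z)) z :=
  hF.hasFDerivAt.comp_hasDerivAt z
    ((hasDerivAt_const z x).prodMk ((hasDerivAt_const z y).prodMk (hasDerivAt_id z)))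

/-! ### Mixed second differences over rectangles in a convex set. -/

/-- The mixed second difference of `F` in the last two variables. -/
def mixedDifference (F : R3 → ℝ) (y z s t x : ℝ) : ℝ :=
  F (x, y, s) - F (x, y, t) - (F (x, z, s) - F (x, z, t))

/-- The four corners of a rectangle orthogonal to the first axis lie in `K`. -/
def CornersMem (K : Set R3) (y z s t x : ℝ) : Prop :=
  (x, y, s) ∈ K ∧ (x, y, t) ∈ K ∧ (x, z, s) ∈ K ∧ (x, z, t) ∈ K

/-- Convexity is used along two opposite edges and then between them. Intermediate points of the
mean value theorem thus stay in the convex hull, where the bounds on the phase hold. -/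
theorem CornersMem.rectangle {K : Set R3} (hK : Convex ℝ K) {y z s t x : ℝ}
    (h : CornersMem K y z s t x) {η ζ : ℝ} (hη : η ∈ Set.uIcc z y) (hζ : ζ ∈ Set.uIcc t s) :
    (x, η, ζ) ∈ K := by
  rw [← segment_eq_uIcc] at hη hζ
  obtain ⟨a, b, ha, hb, hab, rfl⟩ := hη
  obtain ⟨c, d, hc, hd, hcd, rfl⟩ := hζ
  obtain ⟨h1, h2, h3, h4⟩ := h
  have e1 : (x, y, c • t + d • s) ∈ K := by
    have := hK h2 h1 hc hd hcd
    simpa [← add_mul, hab, hcd] using this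
  have e2 : (x, z, c • t + d • s) ∈ K := by
    have := hK h4 h3 hc hd hcd
    simpa [← add_mul, hab, hcd] using this
  have := hK e2 e1 ha hb hab
  simpa [← add_mul, hab, hcd] using this

theorem CornersMem.of_mem_Icc {K : Set R3} (hK : Convex ℝ K) {y z s t p q x : ℝ}
    (hp : CornersMem K y z s t p) (hq : CornersMem K y z s t q) (hx : x ∈ Set.Icc p q) :
    CornersMem K y z s t x := by
  rw [← segment_eq_Icc (hx.1.trans hx.2)] at hx
  obtain ⟨a, b, ha, hb, hab, rfl⟩ := hx
  have key : ∀ {u v : ℝ}, (p, u, v) ∈ K → (q, u, v) ∈ K → (a • p + b • q, u, v) ∈ K := by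
    intro u v h1 h2
    have := hK h1 h2 ha hb hab
    simpa [← add_mul, hab] using this
  exact ⟨key hp.1 hq.1, key hp.2.1 hq.2.1, key hp.2.2.1 hq.2.2.1, key hp.2.2.2 hq.2.2.2⟩

/-- The mean value theorem in `x₂`, applied to the difference of `F` between the heights `s` and
`t`, and then in `x₃`, applied to the resulting derivative. -/
theorem exists_mixedDifference_eq {K : Set R3} (hK : Convex ℝ K) {F : R3 → ℝ}
    (hF : AnalyticOnNhd ℝ F K) {y z s t x : ℝ} (h : CornersMem K y z s t x) :
    ∃ w ∈ K, mixedDifference F y z s t x =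
      (y - z) * (s - t) * partialDeriv 2 (partialDeriv 1 F) w := by
  obtain ⟨η, hη, e1⟩ := exists_hasDerivAt_sub_eq_mul (a := z) (b := y)
    (f := fun η => F (x, η, s) - F (x, η, t))
    (f' := fun η => partialDeriv 1 F (x, η, s) - partialDeriv 1 F (x, η, t)) fun η hη =>
      (hasDerivAt_slice_one (hF _ (h.rectangle hK hη Set.right_mem_uIcc)).differentiableAt).sub
        (hasDerivAt_slice_one (hF _ (h.rectangle hK hη Set.left_mem_uIcc)).differentiableAt)
  obtain ⟨ζ, hζ, e2⟩ := exists_hasDerivAt_sub_eq_mul (a := t) (b := s)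
    (f := fun ζ => partialDeriv 1 F (x, η, ζ))
    (f' := fun ζ => partialDeriv 2 (partialDeriv 1 F) (x, η, ζ)) fun ζ hζ =>
      hasDerivAt_slice_two ((hF _ (h.rectangle hK hη hζ)).partialDeriv 1).differentiableAt
  refine ⟨_, h.rectangle hK hη hζ, ?_⟩
  rw [mixedDifference, e1, e2, mul_assoc]

theorem hasDerivAt_mixedDifference {K : Set R3} {F : R3 → ℝ} (hF : AnalyticOnNhd ℝ F K)
    {y z s t x : ℝ} (h : CornersMem K y z s t x) :
    HasDerivAt (mixedDifference F y z s t) (mixedDifference (partialDeriv 0 F) y z s t x) x :=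
  ((hasDerivAt_slice_zero (hF _ h.1).differentiableAt).sub
    (hasDerivAt_slice_zero (hF _ h.2.1).differentiableAt)).sub
  ((hasDerivAt_slice_zero (hF _ h.2.2.1).differentiableAt).sub
    (hasDerivAt_slice_zero (hF _ h.2.2.2).differentiableAt))

/-! ### The oscillatory kernel and its decay. -/

/-- The oscillating amplitude `e^{iλS} ψ`. -/
noncomputable def oscAmplitude (lam : ℝ) (S : R3 → ℝ) (ψ : R3 → ℂ) (x : R3) : ℂ :=
  Complex.exp (Complex.I * ((lam * S x : ℝ) : ℂ)) * ψ x

theorem norm_oscAmplitude (lam : ℝ) (S : R3 → ℝ) (ψ : R3 → ℂ) (x : R3) :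
    ‖oscAmplitude lam S ψ x‖ = ‖ψ x‖ := by
  rw [oscAmplitude, norm_mul, mul_comm Complex.I, Complex.norm_exp_ofReal_mul_I, one_mul]

theorem continuous_oscAmplitude (lam : ℝ) {S : R3 → ℝ} {ψ : R3 → ℂ} (hψ : Continuous ψ)
    (hS : AnalyticOnNhd ℝ S (convexHull ℝ (tsupport ψ))) :
    Continuous (oscAmplitude lam S ψ) := by
  refine continuous_iff_continuousAt.2 fun x => ?_
  by_cases hx : x ∈ tsupport ψ
  · have : ContinuousAt S x := (hS x (subset_convexHull ℝ _ hx)).continuousAt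
    unfold oscAmplitude
    fun_prop
  · have h0 : ψ =ᶠ[nhds x] 0 := notMem_tsupport_iff_eventuallyEq.1 hx
    have : oscAmplitude lam S ψ =ᶠ[nhds x] fun _ => 0 := by
      filter_upwards [h0] with y hy
      simp [oscAmplitude, hy]
    exact continuousAt_const.congr this.symm

/-- The kernel of the `T T*` operator. -/
noncomputable def oscKernel (lam : ℝ) (S : R3 → ℝ) (ψ : R3 → ℂ) (s t x y : ℝ) : ℂ :=
  oscAmplitude lam S ψ (x, y, s) * (starRingEnd ℂ) (oscAmplitude lam S ψ (x, y, t))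

/-- The amplitude of the integrand of the `T T*` kernel. -/
noncomputable def cornerAmplitude (ψ : R3 → ℂ) (y z s t x : ℝ) : ℂ :=
  ψ (x, y, s) * (starRingEnd ℂ) (ψ (x, y, t)) *
    (starRingEnd ℂ) (ψ (x, z, s) * (starRingEnd ℂ) (ψ (x, z, t)))

/-- Conjugation changes the sign of a real phase, so the four values of `S` combine with the signs
of the mixed difference. -/
theorem oscKernel_mul_conj (lam : ℝ) (S : R3 → ℝ) (ψ : R3 → ℂ) (s t x y z : ℝ) :
    oscKernel lam S ψ s t x y * (starRingEnd ℂ) (oscKernel lam S ψ s t x z) =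
      Complex.exp (Complex.I * ((lam * mixedDifference S y z s t x : ℝ) : ℂ)) *
        cornerAmplitude ψ y z s t x := by
  have e : Complex.exp (Complex.I * ((lam * mixedDifference S y z s t x : ℝ) : ℂ)) =
      Complex.exp (Complex.I * ((lam * S (x, y, s) : ℝ) : ℂ)) *
      (starRingEnd ℂ) (Complex.exp (Complex.I * ((lam * S (x, y, t) : ℝ) : ℂ))) *
      (starRingEnd ℂ) (Complex.exp (Complex.I * ((lam * S (x, z, s) : ℝ) : ℂ)) *
      (starRingEnd ℂ) (Complex.exp (Complex.I * ((lam * S (x, z, t) : ℝ) : ℂ)))) := by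
    simp only [map_mul, ← Complex.exp_conj, Complex.conj_I, Complex.conj_ofReal, map_neg, neg_neg,
      neg_mul]
    simp only [← Complex.exp_add]
    congr 1
    simp only [mixedDifference]
    push_cast
    ring
  rw [e]
  simp only [oscKernel, oscAmplitude, cornerAmplitude, map_mul, Complex.conj_conj]
  ring

theorem CornersMem.of_cornerAmplitude_ne_zero {ψ : R3 → ℂ} {y z s t x : ℝ}
    (h : cornerAmplitude ψ y z s t x ≠ 0) : CornersMem (tsupport ψ) y z s t x := by
  simp only [cornerAmplitude, map_mul, Complex.conj_conj, ne_eq, mul_eq_zero, map_eq_zero,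
    not_or] at h
  exact ⟨subset_tsupport _ h.1.1, subset_tsupport _ h.1.2, subset_tsupport _ h.2.1,
    subset_tsupport _ h.2.2⟩

theorem LocalEstimateHyp.scaledC2Bound {S : R3 → ℝ} {ψ : R3 → ℂ} {b μ C₁ C₂ : ℝ}
    (hψ : ContDiff ℝ ∞ ψ) (h : LocalEstimateHyp 0 S ψ b μ C₁ C₂) (y z : ℝ) :
    ScaledC2Bound (fun x => ψ (x, y, z)) C₁ b := by
  have hP : ContDiff ℝ ∞ (partialDeriv 0 ψ) := by
    have := hψ.fderiv_right (m := ∞) (by simp)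
    exact this.clm_apply contDiff_const
  have h1 : deriv (fun x => ψ (x, y, z)) = fun x => partialDeriv 0 ψ (x, y, z) :=
    funext fun x => (hasDerivAt_slice_zero (hψ.differentiable (by simp) _)).deriv
  have h2 : deriv (fun x => partialDeriv 0 ψ (x, y, z)) =
      fun x => partialDeriv 0 (partialDeriv 0 ψ) (x, y, z) :=
    funext fun x => (hasDerivAt_slice_zero (hP.differentiable (by simp) _)).deriv
  refine ⟨(contDiff_infty.1 hψ 2).comp (by fun_prop),
    fun x => ?_, fun x => ?_, fun x => ?_⟩
  · simpa using h.cutoff_bound 0 (by norm_num) (x, y, z)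
  · rw [h1]; simpa using h.cutoff_bound 1 (by norm_num) (x, y, z)
  · rw [h1, h2]; exact h.cutoff_bound 2 le_rfl (x, y, z)

theorem ScaledC2Bound.cornerAmplitude {ψ : R3 → ℂ} {b C₁ : ℝ} (hb : 0 < b)
    (h : ∀ y z, ScaledC2Bound (fun x => ψ (x, y, z)) C₁ b) (y z s t : ℝ) :
    ScaledC2Bound (cornerAmplitude ψ y z s t) (64 * C₁ ^ 4) b := by
  have := (((h y s).mul hb (h y t).conj).mul hb ((h z s).mul hb (h z t).conj).conj)
  rw [show 4 * (4 * (C₁ * C₁) * (4 * (C₁ * C₁))) = 64 * C₁ ^ 4 by ring] at this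
  exact this

theorem integral_eq_intervalIntegral_of_zero_off {f : ℝ → ℂ} {p q : ℝ} (hpq : p ≤ q)
    (h : ∀ x ∉ Set.Icc p q, f x = 0) : ∫ x, f x = ∫ x in p..q, f x := by
  rw [intervalIntegral.integral_of_le hpq, ← integral_Icc_eq_integral_Ioc,
    setIntegral_eq_integral_of_forall_compl_eq_zero h]

/-- The constant in the kernel estimate. -/
noncomputable def kernelConst (C₁ C₂ : ℝ) : ℝ := 64 * C₁ ^ 4 * (1 + 4 * C₂ + 3 * C₂ ^ 2)

/-- The phase has `x₁`-derivative of size at least `μ |s - t| |y - z|`, and its next two derivatives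
obey matching bounds, so the second order oscillatory estimate applies. Adding the trivial bound
keeps the result useful when the oscillation is weak. -/
theorem norm_integral_oscKernel_le {lam μ b C₁ C₂ : ℝ} {S : R3 → ℝ} {ψ : R3 → ℂ}
    (hlam : lam ≠ 0) (hμ : 0 < μ) (hb : 0 < b) (hC₂ : 0 < C₂)
    (hψ : ContDiff ℝ ∞ ψ)
    (hS : AnalyticOnNhd ℝ S (convexHull ℝ (tsupport ψ)))
    (h : LocalEstimateHyp 0 S ψ b μ C₁ C₂) (s t y z : ℝ) :
    ‖∫ x, oscKernel lam S ψ s t x y * (starRingEnd ℂ) (oscKernel lam S ψ s t x z)‖ ≤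
      2 * kernelConst C₁ C₂ * b * (1 + (|lam| * μ * b * |s - t| * (y - z)) ^ 2)⁻¹ := by
  set K := convexHull ℝ (tsupport ψ) with hK
  have hKc : Convex ℝ K := convex_convexHull ℝ _
  have hsub : tsupport ψ ⊆ K := subset_convexHull ℝ _
  have hD : 0 ≤ kernelConst C₁ C₂ := by unfold kernelConst; positivity
  simp_rw [oscKernel_mul_conj]
  set a := cornerAmplitude ψ y z s t with ha
  have hA : ScaledC2Bound a (64 * C₁ ^ 4) b :=
    ScaledC2Bound.cornerAmplitude hb (h.scaledC2Bound hψ) y z s t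
  -- The integral is taken over the interval from `sInf Z` to `sSup Z`, not over a side of the box.
  -- At both ends the four corners lie in the support, so by convexity they lie in `K` for every `x`
  -- in between, which the box does not ensure.
  set Z : Set ℝ := {x | CornersMem (tsupport ψ) y z s t x} with hZ
  obtain ⟨lo, hi, hw, hbox⟩ := h.support_subset
  have hw' : hi.1 - lo.1 = b := by simpa [coord] using hw
  have hZsub : Z ⊆ Set.Icc lo.1 hi.1 := fun x hx =>
    ⟨(hbox hx.1).1.1, (hbox hx.1).2.1⟩
  have hZclosed : IsClosed Z := by
    have hcl := isClosed_tsupport ψ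
    have cl : ∀ u v : ℝ, IsClosed {x : ℝ | (x, u, v) ∈ tsupport ψ} := fun u v =>
      hcl.preimage (by fun_prop : Continuous fun x : ℝ => ((x, u, v) : R3))
    exact (cl y s).inter ((cl y t).inter ((cl z s).inter (cl z t)))
  have hZc : IsCompact Z := isCompact_Icc.of_isClosed_subset hZclosed hZsub
  have ha0 : ∀ x, x ∉ Z → a x = 0 := fun x hx => by
    by_contra hne
    exact hx (CornersMem.of_cornerAmplitude_ne_zero hne)
  rcases Z.eq_empty_or_nonempty with hem | hne
  · have : ∀ x, a x = 0 := fun x => ha0 x (by simp [hem])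
    simp only [this, mul_zero, integral_zero, norm_zero]
    positivity
  set p := sInf Z
  set q := sSup Z
  have hpZ : p ∈ Z := hZc.sInf_mem hne
  have hqZ : q ∈ Z := hZc.sSup_mem hne
  have hZpq : Z ⊆ Set.Icc p q := fun x hx => ⟨csInf_le hZc.bddBelow hx, le_csSup hZc.bddAbove hx⟩
  have hpq : p ≤ q := (hZpq hpZ).2
  have hlen : q - p ≤ b := by
    have := (hZsub hpZ).1
    have := (hZsub hqZ).2
    linarith
  have haL : ∀ x < p, a x = 0 := fun x hx => ha0 x fun hxZ => hx.not_ge (hZpq hxZ).1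
  have haR : ∀ x, q < x → a x = 0 := fun x hx => ha0 x fun hxZ => hx.not_ge (hZpq hxZ).2
  have hcor : ∀ x ∈ Set.Icc p q, CornersMem K y z s t x := fun x hx =>
    CornersMem.of_mem_Icc hKc ⟨hsub hpZ.1, hsub hpZ.2.1, hsub hpZ.2.2.1, hsub hpZ.2.2.2⟩
      ⟨hsub hqZ.1, hsub hqZ.2.1, hsub hqZ.2.2.1, hsub hqZ.2.2.2⟩ hx
  rw [integral_eq_intervalIntegral_of_zero_off hpq fun x hx => by
    rw [ha0 x fun hxZ => hx (hZpq hxZ), mul_zero]]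
  set V := ‖∫ x in p..q, Complex.exp (Complex.I * ((lam * mixedDifference S y z s t x : ℝ) : ℂ)) *
    a x‖ with hV
  have hAD : 64 * C₁ ^ 4 ≤ kernelConst C₁ C₂ :=
    le_mul_of_one_le_right (by positivity) (by nlinarith [sq_nonneg C₂])
  have trivial_bound : V ≤ kernelConst C₁ C₂ * b := by
    refine (intervalIntegral.norm_integral_le_of_norm_le_const (C := 64 * C₁ ^ 4)
      fun x hx => ?_).trans ?_
    · rw [norm_mul, mul_comm Complex.I, Complex.norm_exp_ofReal_mul_I, one_mul]
      exact hA.bound x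
    · rw [abs_of_nonneg (sub_nonneg.2 hpq)]
      gcongr
  set X := |lam| * μ * b * |s - t| * (y - z) with hX
  -- In product form the estimate also covers `s = t` and `y = z`, where it is trivial; summed with
  -- `trivial_bound` it gives `V (1 + X²) ≤ 2 D b`, with `D` the kernel constant.
  have osc_bound : V * X ^ 2 ≤ kernelConst C₁ C₂ * b := by
    rcases eq_or_ne (|s - t| * |y - z|) 0 with h0 | h0
    · have : X ^ 2 = (|lam| * μ * b * (|s - t| * |y - z|)) ^ 2 := by
        rw [hX, ← sq_abs]
        simp only [abs_mul, abs_abs, abs_of_pos hμ, abs_of_pos hb]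
        ring
      rw [this, h0]
      simp only [mul_zero, ne_eq, OfNat.ofNat_ne_zero, not_false_eq_true, zero_pow]
      positivity
    have hr : 0 < |s - t| * |y - z| := lt_of_le_of_ne (by positivity) h0.symm
    have hm : 0 < μ * (|s - t| * |y - z|) := by positivity
    have hP0 : AnalyticOnNhd ℝ (partialDeriv 0 S) K := fun x hx => (hS x hx).partialDeriv 0
    have hP1 : AnalyticOnNhd ℝ (partialDeriv 0 (partialDeriv 0 S)) K := fun x hx =>
      (hP0 x hx).partialDeriv 0
    have hP2 : AnalyticOnNhd ℝ (partialDeriv 0 (partialDeriv 0 (partialDeriv 0 S))) K :=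
      fun x hx => (hP1 x hx).partialDeriv 0
    -- The first three `x₁`-derivatives of the phase are mixed differences of `∂₁S`, `∂₁²S`, `∂₁³S`;
    -- their mean values are expressed through `D3 S` and its `x₁`-derivatives, to which the
    -- hypotheses apply.
    have hP3 : ∀ w ∈ K, partialDeriv 2 (partialDeriv 1 (partialDeriv 0 S)) w = D3 S w :=
      fun w hw => (partialDeriv_two_one_zero (hS w hw)).eq_of_nhds
    have hP4 : ∀ w ∈ K, partialDeriv 2 (partialDeriv 1 (partialDeriv 0 (partialDeriv 0 S))) w =
        partialDeriv 0 (D3 S) w := fun w hw =>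
      ((partialDeriv_two_one_zero (hP0 w hw)).trans (D3_partialDeriv_zero (hS w hw))).eq_of_nhds
    have hP5 : ∀ w ∈ K, partialDeriv 2 (partialDeriv 1
        (partialDeriv 0 (partialDeriv 0 (partialDeriv 0 S)))) w =
        partialDeriv 0 (partialDeriv 0 (D3 S)) w := fun w hw =>
      ((partialDeriv_two_one_zero (hP1 w hw)).trans ((D3_partialDeriv_zero (hP0 w hw)).trans
        (partialDeriv_congr (D3_partialDeriv_zero (hS w hw)) 0))).eq_of_nhds
    have main := norm_integral_exp_phase_mul_le (lam := lam) (m := μ * (|s - t| * |y - z|))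
      (B := C₂) hlam hpq hm hb hA.nonneg hC₂.le hlen
      (fun x hx => hasDerivAt_mixedDifference hS (hcor x hx))
      (fun x hx => hasDerivAt_mixedDifference hP0 (hcor x hx))
      (fun x hx => hasDerivAt_mixedDifference hP1 (hcor x hx))
      (fun x hx => (hasDerivAt_mixedDifference hP2 (hcor x hx)).continuousAt.continuousWithinAt)
      (fun x _ => hA.hasDerivAt x) (fun x _ => hA.hasDerivAt_deriv x)
      hA.continuous_deriv2.continuousOn
      (fun x hx => by
        obtain ⟨w, hw, e⟩ := exists_mixedDifference_eq hKc hP0 (hcor x hx)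
        rw [e, hP3 w hw, abs_mul, abs_mul]
        have := h.lower_bound w hw
        calc _ = |y - z| * |s - t| * μ := by ring
          _ ≤ _ := by gcongr)
      (fun x hx => by
        obtain ⟨w, hw, e⟩ := exists_mixedDifference_eq hKc hP1 (hcor x hx)
        rw [e, hP4 w hw, abs_mul, abs_mul]
        have := h.deriv_bound w hw
        calc _ ≤ |y - z| * |s - t| * (C₂ * μ * b⁻¹) := by gcongr
          _ = _ := by ring)
      (fun x hx => by
        obtain ⟨w, hw, e⟩ := exists_mixedDifference_eq hKc hP2 (hcor x hx)
        rw [e, hP5 w hw, abs_mul, abs_mul]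
        have := h.deriv2_bound w hw
        calc _ ≤ |y - z| * |s - t| * (C₂ * μ * (b ^ 2)⁻¹) := by gcongr
          _ = _ := by ring)
      (fun x _ => hA.bound x) (fun x _ => hA.bound_deriv x) (fun x _ => hA.bound_deriv2 x)
      (eq_zero_of_Iio hA.contDiff.continuous haL) (eq_zero_of_Ioi hA.contDiff.continuous haR)
      (eq_zero_of_Iio hA.contDiff_deriv.continuous (deriv_eq_zero_of_Iio haL))
      (eq_zero_of_Ioi hA.contDiff_deriv.continuous (deriv_eq_zero_of_Ioi haR))
    have hl : 0 < |lam| := abs_pos.2 hlam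
    have hX2 : X ^ 2 = (|lam| * (μ * (|s - t| * |y - z|)) * b) ^ 2 := by
      rw [hX, ← sq_abs]
      simp only [abs_mul, abs_abs, abs_of_pos hμ, abs_of_pos hb]
      ring
    rw [hX2]
    exact (le_div_iff₀ (by positivity)).1 main
  rw [← div_eq_mul_inv, le_div_iff₀ (by positivity)]
  linarith

/-! ### Estimates for a fixed pair of slices, and integration over pairs. -/

theorem lintegral_cauchyKernel {c A : ℝ} (hc : 0 < c) (hA : 0 ≤ A) (y : ℝ) :
    ∫⁻ z, ENNReal.ofReal (A * (1 + (c * (y - z)) ^ 2)⁻¹) = ENNReal.ofReal (A * (Real.pi / c)) := by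
  rw [lintegral_sub_left_eq_self (fun r => ENNReal.ofReal (A * (1 + (c * r) ^ 2)⁻¹)) y,
    ← ofReal_integral_eq_lintegral_ofReal
      ((integrable_inv_one_add_sq.comp_mul_left' hc.ne').const_mul A)
      (Filter.Eventually.of_forall fun r => by positivity),
    integral_const_mul, Measure.integral_comp_mul_left (fun r => (1 + r ^ 2)⁻¹) c,
    integral_univ_inv_one_add_sq, abs_of_pos (inv_pos.2 hc), smul_eq_mul, div_eq_inv_mul]

/-- With the `x` integral moved outside, Hardy–Littlewood–Sobolev applies to `‖f (x, ·)‖²`. The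
exponents match the mixed norm because `2 · 4/3 = 8/3` and `3/2 = 4 / (8/3)`. -/
theorem lintegral_rieszKernel_mul_sq_le {f : ℝ × ℝ → ℂ} (hf : Measurable f) :
    ∫⁻ p : ℝ × ℝ, rieszKernel (p.1 - p.2) *
        ∫⁻ x, (‖f (x, p.1)‖ₑ ^ (2 : ℝ) * ‖f (x, p.2)‖ₑ ^ (2 : ℝ)) ≤
      12 * mixedNorm 4 (8 / 3) f ^ (4 : ℝ) := by
  have hm : Measurable fun q : ℝ × ℝ => ‖f q‖ₑ ^ (2 : ℝ) := hf.enorm.pow_const _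
  have hk : Measurable fun p : ℝ × ℝ => rieszKernel (p.1 - p.2) :=
    measurable_rieszKernel.comp (measurable_fst.sub measurable_snd)
  have hJ : Measurable (Function.uncurry fun (p : ℝ × ℝ) (x : ℝ) =>
      rieszKernel (p.1 - p.2) * (‖f (x, p.1)‖ₑ ^ (2 : ℝ) * ‖f (x, p.2)‖ₑ ^ (2 : ℝ))) :=
    (hk.comp measurable_fst).mul
      ((hm.comp (measurable_snd.prodMk (measurable_fst.comp measurable_fst))).mul
        (hm.comp (measurable_snd.prodMk (measurable_snd.comp measurable_fst))))
  calc _ = ∫⁻ p : ℝ × ℝ, ∫⁻ x, rieszKernel (p.1 - p.2) *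
        (‖f (x, p.1)‖ₑ ^ (2 : ℝ) * ‖f (x, p.2)‖ₑ ^ (2 : ℝ)) := by
        refine lintegral_congr fun p => (lintegral_const_mul _ ?_).symm
        exact (hm.comp (measurable_id.prodMk measurable_const)).mul
          (hm.comp (measurable_id.prodMk measurable_const))
    _ = ∫⁻ x, ∫⁻ p : ℝ × ℝ, rieszKernel (p.1 - p.2) *
        (‖f (x, p.1)‖ₑ ^ (2 : ℝ) * ‖f (x, p.2)‖ₑ ^ (2 : ℝ)) :=
        lintegral_lintegral_swap hJ.aemeasurable
    _ ≤ ∫⁻ x, 12 * (∫⁻ y, ‖f (x, y)‖ₑ ^ (8 / 3 : ℝ)) ^ (3 / 2 : ℝ) := by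
        refine lintegral_mono fun x => ?_
        have hx : Measurable fun y => ‖f (x, y)‖ₑ ^ (2 : ℝ) :=
          hm.comp (measurable_const.prodMk measurable_id)
        have hx' : Measurable fun p : ℝ × ℝ => rieszKernel (p.1 - p.2) *
            (‖f (x, p.1)‖ₑ ^ (2 : ℝ) * ‖f (x, p.2)‖ₑ ^ (2 : ℝ)) :=
          hk.mul ((hx.comp measurable_fst).mul (hx.comp measurable_snd))
        rw [Measure.volume_eq_prod, lintegral_prod _ hx'.aemeasurable]
        refine (hardyLittlewoodSobolev_half hx).trans_eq ?_
        simp_rw [← ENNReal.rpow_mul]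
        norm_num
    _ = _ := by
        rw [lintegral_const_mul _ ((hf.enorm.pow_const _).lintegral_prod_right'.pow_const _),
          mixedNorm, ← ENNReal.rpow_mul]
        norm_num

theorem continuous_oscKernel {lam : ℝ} {S : R3 → ℝ} {ψ : R3 → ℂ}
    (hE : Continuous (oscAmplitude lam S ψ)) (s t : ℝ) :
    Continuous (Function.uncurry (oscKernel lam S ψ s t)) :=
  (hE.comp (by fun_prop : Continuous fun p : ℝ × ℝ => ((p.1, p.2, s) : R3))).mul
    (Complex.continuous_conj.comp
      (hE.comp (by fun_prop : Continuous fun p : ℝ × ℝ => ((p.1, p.2, t) : R3))))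

/-- The `T T*` bound for slices at two different heights: the Schur constant is of order `1 / (|λ| μ
|s - t|)`, and its square root produces the kernel of fractional integration. -/
theorem enorm_bilinear_oscKernel_le {lam μ b C₁ C₂ : ℝ} {S : R3 → ℝ} {ψ : R3 → ℂ}
    (hlam : lam ≠ 0) (hμ : 0 < μ) (hb : 0 < b) (hC₂ : 0 < C₂) (hψ : ContDiff ℝ ∞ ψ)
    (hS : AnalyticOnNhd ℝ S (convexHull ℝ (tsupport ψ)))
    (h : LocalEstimateHyp 0 S ψ b μ C₁ C₂) {lo hi : R3} (hbox : tsupport ψ ⊆ Set.Icc lo hi)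
    {f₁ f₂ : ℝ × ℝ → ℂ} (hf₁ : Measurable f₁) (hf₂ : Measurable f₂) {N : ℝ}
    (hN : ∀ q, ‖f₁ q‖ ≤ N) {s t : ℝ} (hst : s ≠ t) :
    ‖∫ x in Set.Icc lo.1 hi.1, f₂ (x, s) * (starRingEnd ℂ) (f₂ (x, t)) *
        ∫ y in Set.Icc lo.2.1 hi.2.1, oscKernel lam S ψ s t x y *
          (f₁ (y, s) * (starRingEnd ℂ) (f₁ (y, t)))‖ₑ ≤
      ENNReal.ofReal ((4 * Real.pi * kernelConst C₁ C₂ * (|lam| * μ)⁻¹) ^ (1 / 2 : ℝ)) *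
        (rieszKernel (s - t) *
        ((∫⁻ y, ‖f₁ (y, s)‖ₑ ^ (2 : ℝ) * ‖f₁ (y, t)‖ₑ ^ (2 : ℝ)) ^ (1 / 2 : ℝ) *
        (∫⁻ x, ‖f₂ (x, s)‖ₑ ^ (2 : ℝ) * ‖f₂ (x, t)‖ₑ ^ (2 : ℝ)) ^ (1 / 2 : ℝ))) := by
  have hE := continuous_oscAmplitude lam hψ.continuous hS
  have hl : 0 < |lam| := abs_pos.2 hlam
  have hr : 0 < |s - t| := abs_pos.2 (sub_ne_zero.2 hst)
  have hD : 0 ≤ kernelConst C₁ C₂ := by unfold kernelConst; positivity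
  set c := |lam| * μ * b * |s - t| with hc
  have hcp : 0 < c := by positivity
  set H : ℝ → ℝ → ℝ≥0∞ := fun y z =>
    ENNReal.ofReal (2 * kernelConst C₁ C₂ * b * (1 + (c * (y - z)) ^ 2)⁻¹) with hH
  have hψ0 : ∀ x, ‖ψ x‖ ≤ C₁ := fun x => by simpa using h.cutoff_bound 0 (by norm_num) x
  have hC₁ : 0 ≤ C₁ := (norm_nonneg _).trans (hψ0 0)
  have hkb : ∀ x y, ‖oscKernel lam S ψ s t x y‖ ≤ C₁ * C₁ := fun x y => by
    rw [oscKernel, norm_mul, RCLike.norm_conj, norm_oscAmplitude, norm_oscAmplitude]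
    exact mul_le_mul (hψ0 _) (hψ0 _) (norm_nonneg _) hC₁
  have hslice : ∀ {f : ℝ × ℝ → ℂ}, Measurable f →
      StronglyMeasurable fun y => f (y, s) * (starRingEnd ℂ) (f (y, t)) := fun hf =>
    ((hf.comp (measurable_id.prodMk measurable_const)).stronglyMeasurable).mul
      (Complex.continuous_conj.comp_stronglyMeasurable
        (hf.comp (measurable_id.prodMk measurable_const)).stronglyMeasurable)
  have hkH : ∀ y z, ‖∫ x in Set.Icc lo.1 hi.1, oscKernel lam S ψ s t x y *
      (starRingEnd ℂ) (oscKernel lam S ψ s t x z)‖ₑ ≤ H y z := fun y z => by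
    rw [setIntegral_eq_integral_of_forall_compl_eq_zero, ← ofReal_norm]
    · exact ENNReal.ofReal_le_ofReal
        (norm_integral_oscKernel_le hlam hμ hb hC₂ hψ hS h s t y z)
    · intro x hx
      have : (x, y, s) ∉ tsupport ψ := fun hx' => hx ⟨(hbox hx').1.1, (hbox hx').2.1⟩
      simp [oscKernel, oscAmplitude, image_eq_zero_of_notMem_tsupport this]
  have key := enorm_integral_bilinear_le (volume.restrict (Set.Icc lo.1 hi.1))
    (volume.restrict (Set.Icc lo.2.1 hi.2.1)) (continuous_oscKernel hE s t).stronglyMeasurable hkb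
    (hslice hf₁) (N := N * N) (fun y => by
      rw [norm_mul, RCLike.norm_conj]
      exact mul_le_mul (hN _) (hN _) (norm_nonneg _) ((norm_nonneg _).trans (hN (0, 0))))
    (hslice hf₂) (H := H) (by unfold Function.uncurry; simp only [hH]; fun_prop)
    (fun y z => by simp only [hH]; congr 4; ring) hkH
    (A := ENNReal.ofReal (2 * kernelConst C₁ C₂ * b * (Real.pi / c))) (fun y =>
      (lintegral_mono' Measure.restrict_le_self le_rfl).trans_eq
        (lintegral_cauchyKernel hcp (by positivity) y))
  refine key.trans ?_
  -- The width `b` cancels here, since `c` contains the factor `b`. The constant `4π` collects `2`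
  -- from Schur's test, `2` from the kernel bound and `π` from the integral of `1 / (1 + r²)`.
  have hconst : (2 * ENNReal.ofReal (2 * kernelConst C₁ C₂ * b * (Real.pi / c))) ^ (1 / 2 : ℝ) =
      ENNReal.ofReal ((4 * Real.pi * kernelConst C₁ C₂ * (|lam| * μ)⁻¹) ^ (1 / 2 : ℝ)) *
        rieszKernel (s - t) := by
    rw [rieszKernel, ← ENNReal.ofReal_mul (by positivity),
      show (2 : ℝ≥0∞) = ENNReal.ofReal 2 by simp, ← ENNReal.ofReal_mul (by norm_num),
      ENNReal.ofReal_rpow_of_nonneg (by positivity) (by norm_num), Real.rpow_neg hr.le,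
      ← Real.inv_rpow hr.le, ← Real.mul_rpow (by positivity) (by positivity)]
    congr 2
    rw [hc]
    field_simp
    ring
  rw [hconst, mul_assoc, mul_assoc]
  gcongr
  · exact Measure.restrict_le_self
  · rw [enorm_mul, RCLike.enorm_conj, ENNReal.mul_rpow_of_nonneg _ _ (by norm_num)]
  · exact Measure.restrict_le_self
  · rw [enorm_mul, RCLike.enorm_conj, ENNReal.mul_rpow_of_nonneg _ _ (by norm_num)]

theorem restrict_Icc_eq_prod (lo hi : R3) :
    (volume : Measure R3).restrict (Set.Icc lo hi) =
      (volume.restrict (Set.Icc lo.1 hi.1)).prod ((volume.restrict (Set.Icc lo.2.1 hi.2.1)).prod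
        (volume.restrict (Set.Icc lo.2.2 hi.2.2))) := by
  rw [Measure.prod_restrict, Measure.prod_restrict, Set.Icc_prod_Icc, Set.Icc_prod_Icc]
  rfl

theorem integrand3_eq_zero_of_notMem {lam : ℝ} {S : R3 → ℝ} {ψ : R3 → ℂ} {lo hi : R3}
    (hbox : tsupport ψ ⊆ Set.Icc lo hi) (f₁ f₂ f₃ : ℝ × ℝ → ℂ) (x : R3) (hx : x ∉ Set.Icc lo hi) :
    integrand3 lam S ψ f₁ f₂ f₃ x = 0 := by
  simp [integrand3, image_eq_zero_of_notMem_tsupport fun h => hx (hbox h)]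

/-- The slice estimate needs `s ≠ t`; the excluded diagonal is a null set. -/
theorem ae_prod_restrict_ne (I J : Set ℝ) :
    ∀ᵐ p ∂((volume.restrict I).prod (volume.restrict J) : Measure (ℝ × ℝ)), p.1 ≠ p.2 := by
  have hm : MeasurableSet {p : ℝ × ℝ | p.1 ≠ p.2} :=
    (measurableSet_eq_fun measurable_fst measurable_snd).compl
  rw [Measure.ae_prod_iff_ae_ae hm]
  refine Filter.Eventually.of_forall fun x => ?_
  have : ∀ᵐ y ∂(volume.restrict J : Measure ℝ), y ≠ x := by
    rw [ae_iff]
    simp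
  filter_upwards [this] with y hy using hy.symm

/-! ### The estimate for bounded functions. -/

/-- The main estimate for bounded functions. -/
theorem enorm_Lambda3_le_of_bounded {lam μ b C₁ C₂ : ℝ} {S : R3 → ℝ} {ψ : R3 → ℂ}
    (hlam : lam ≠ 0) (hμ : 0 < μ) (hb : 0 < b) (hC₂ : 0 < C₂) (hψ : ContDiff ℝ ∞ ψ)
    (hS : AnalyticOnNhd ℝ S (convexHull ℝ (tsupport ψ)))
    (h : LocalEstimateHyp 0 S ψ b μ C₁ C₂)
    {f₁ f₂ f₃ : ℝ × ℝ → ℂ} (hf₁ : Measurable f₁) (hf₂ : Measurable f₂) (hf₃ : Measurable f₃)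
    {N : ℝ} (hN₁ : ∀ q, ‖f₁ q‖ ≤ N) (hN₂ : ∀ q, ‖f₂ q‖ ≤ N) (hN₃ : ∀ q, ‖f₃ q‖ ≤ N) :
    ‖Lambda3 lam S ψ f₁ f₂ f₃‖ₑ ≤
      (12 * ENNReal.ofReal ((4 * Real.pi * kernelConst C₁ C₂ * (|lam| * μ)⁻¹) ^ (1 / 2 : ℝ))) ^
        (1 / 2 : ℝ) * mixedNorm 4 (8 / 3) f₁ * mixedNorm 4 (8 / 3) f₂ * eLpNorm f₃ 2 volume := by
  obtain ⟨lo, hi, -, hbox⟩ := h.support_subset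
  have hE := continuous_oscAmplitude lam hψ.continuous hS
  have hψ0 : ∀ x, ‖ψ x‖ ≤ C₁ := fun x => by simpa using h.cutoff_bound 0 (by norm_num) x
  have hC₁ : 0 ≤ C₁ := (norm_nonneg _).trans (hψ0 0)
  have hN : 0 ≤ N := (norm_nonneg _).trans (hN₁ 0)
  set ν₁ := (volume : Measure ℝ).restrict (Set.Icc lo.1 hi.1)
  set ν₂ := (volume : Measure ℝ).restrict (Set.Icc lo.2.1 hi.2.1)
  set ν₃ := (volume : Measure ℝ).restrict (Set.Icc lo.2.2 hi.2.2)
  set Q := ENNReal.ofReal ((4 * Real.pi * kernelConst C₁ C₂ * (|lam| * μ)⁻¹) ^ (1 / 2 : ℝ))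
  set g : ℝ × ℝ → ℝ → ℂ := fun p z =>
    oscAmplitude lam S ψ (p.1, p.2, z) * (f₁ (p.2, z) * f₂ (p.1, z)) with hg
  have hgm : Measurable (Function.uncurry g) := by
    refine (hE.measurable.comp (by fun_prop :
      Measurable fun q : (ℝ × ℝ) × ℝ => ((q.1.1, q.1.2, q.2) : R3))).mul
      ((hf₁.comp (by fun_prop : Measurable fun q : (ℝ × ℝ) × ℝ => (q.1.2, q.2))).mul
        (hf₂.comp (by fun_prop : Measurable fun q : (ℝ × ℝ) × ℝ => (q.1.1, q.2))))
  have hgb : ∀ p z, ‖g p z‖ ≤ C₁ * (N * N) := fun p z => by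
    rw [hg]
    simp only [norm_mul, norm_oscAmplitude]
    exact mul_le_mul (hψ0 _) (mul_le_mul (hN₁ _) (hN₂ _) (norm_nonneg _) hN)
      (by positivity) hC₁
  have hΛ : Lambda3 lam S ψ f₁ f₂ f₃ = ∫ p, f₃ p * ∫ z, g p z ∂ν₃ ∂(ν₁.prod ν₂) := by
    have hint : Integrable (fun q : (ℝ × ℝ) × ℝ => f₃ q.1 * g q.1 q.2) ((ν₁.prod ν₂).prod ν₃) := by
      refine Integrable.of_bound ((hf₃.comp measurable_fst).mul hgm).aestronglyMeasurable
        (N * (C₁ * (N * N))) (Filter.Eventually.of_forall fun q => ?_)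
      rw [norm_mul]
      exact mul_le_mul (hN₃ _) (hgb _ _) (norm_nonneg _) hN
    rw [Lambda3, ← setIntegral_eq_integral_of_forall_compl_eq_zero
      (integrand3_eq_zero_of_notMem hbox f₁ f₂ f₃), restrict_Icc_eq_prod,
      ← (measurePreserving_prodAssoc ν₁ ν₂ ν₃).integral_comp
        MeasurableEquiv.prodAssoc.measurableEmbedding]
    have e : ∀ q : (ℝ × ℝ) × ℝ, integrand3 lam S ψ f₁ f₂ f₃ (MeasurableEquiv.prodAssoc q) =
        f₃ q.1 * g q.1 q.2 := fun q => by
      simp only [integrand3, hg, oscAmplitude, MeasurableEquiv.prodAssoc, MeasurableEquiv.coe_mk,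
        Equiv.prodAssoc_apply]
      ring
    simp_rw [e]
    rw [integral_prod _ hint]
    refine integral_congr_ae (Filter.Eventually.of_forall fun p => ?_)
    exact integral_const_mul (L := ℂ) (f₃ p) (g p)
  set U : (ℝ × ℝ → ℂ) → ℝ × ℝ → ℝ≥0∞ := fun f p =>
    ∫⁻ x, (‖f (x, p.1)‖ₑ ^ (2 : ℝ) * ‖f (x, p.2)‖ₑ ^ (2 : ℝ)) with hU
  have hUm : ∀ {f : ℝ × ℝ → ℂ}, Measurable f → Measurable (U f) := fun {f} hf => by
    have hm : Measurable fun q : ℝ × ℝ => ‖f q‖ₑ ^ (2 : ℝ) := hf.enorm.pow_const _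
    exact Measurable.lintegral_prod_right'
      (f := fun q : (ℝ × ℝ) × ℝ => ‖f (q.2, q.1.1)‖ₑ ^ (2 : ℝ) * ‖f (q.2, q.1.2)‖ₑ ^ (2 : ℝ))
      ((hm.comp (measurable_snd.prodMk (measurable_fst.comp measurable_fst))).mul
        (hm.comp (measurable_snd.prodMk (measurable_snd.comp measurable_fst))))
  have hkm : Measurable fun p : ℝ × ℝ => rieszKernel (p.1 - p.2) :=
    measurable_rieszKernel.comp (measurable_fst.sub measurable_snd)
  have hpair : ∀ᵐ p : ℝ × ℝ ∂(ν₃.prod ν₃),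
      ‖∫ x, g x p.1 * (starRingEnd ℂ) (g x p.2) ∂(ν₁.prod ν₂)‖ₑ ≤
      Q * ((rieszKernel (p.1 - p.2) * U f₁ p) ^ (1 / 2 : ℝ) *
        (rieszKernel (p.1 - p.2) * U f₂ p) ^ (1 / 2 : ℝ)) := by
    filter_upwards [ae_prod_restrict_ne _ _] with p hp
    have hint : Integrable (fun x => g x p.1 * (starRingEnd ℂ) (g x p.2)) (ν₁.prod ν₂) := by
      refine Integrable.of_bound ((hgm.comp (measurable_id.prodMk measurable_const)).mul
        (Complex.continuous_conj.measurable.comp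
          (hgm.comp (measurable_id.prodMk measurable_const)))).aestronglyMeasurable
        (C₁ * (N * N) * (C₁ * (N * N))) (Filter.Eventually.of_forall fun q => ?_)
      rw [norm_mul, RCLike.norm_conj]
      exact mul_le_mul (hgb _ _) (hgb _ _) (norm_nonneg _) (by positivity)
    have e : ∫ x, g x p.1 * (starRingEnd ℂ) (g x p.2) ∂(ν₁.prod ν₂) =
        ∫ x, f₂ (x, p.1) * (starRingEnd ℂ) (f₂ (x, p.2)) *
        ∫ y, oscKernel lam S ψ p.1 p.2 x y *
          (f₁ (y, p.1) * (starRingEnd ℂ) (f₁ (y, p.2))) ∂ν₂ ∂ν₁ := by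
      rw [integral_prod _ hint]
      refine integral_congr_ae (Filter.Eventually.of_forall fun x => ?_)
      dsimp only
      rw [← integral_const_mul]
      refine integral_congr_ae (Filter.Eventually.of_forall fun y => ?_)
      simp only [hg, oscKernel, map_mul]
      ring
    rw [e]
    refine (enorm_bilinear_oscKernel_le hlam hμ hb hC₂ hψ hS h hbox hf₁ hf₂ hN₁ hp).trans_eq ?_
    rw [ENNReal.mul_rpow_of_nonneg _ _ (by norm_num), ENNReal.mul_rpow_of_nonneg _ _ (by norm_num)]
    -- The kernel is shared equally between `f₁` and `f₂`, so that after Cauchy–Schwarz in `(s, t)`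
    -- each function meets one full kernel.
    have : rieszKernel (p.1 - p.2) = rieszKernel (p.1 - p.2) ^ (1 / 2 : ℝ) *
        rieszKernel (p.1 - p.2) ^ (1 / 2 : ℝ) := by
      rw [← ENNReal.rpow_add_of_nonneg _ _ (by norm_num) (by norm_num)]
      norm_num
    conv_lhs => rw [this]
    simp only [hU]
    ring
  have hHLS : ∀ {f : ℝ × ℝ → ℂ}, Measurable f →
      ∫⁻ p, rieszKernel (p.1 - p.2) * U f p ∂(ν₃.prod ν₃) ≤
        12 * mixedNorm 4 (8 / 3) f ^ (4 : ℝ) := fun hf => by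
    refine le_trans (lintegral_mono' ?_ le_rfl) (lintegral_rieszKernel_mul_sq_le hf)
    rw [Measure.prod_restrict]
    exact Measure.restrict_le_self
  have hG : ∫⁻ p, ‖∫ z, g p z ∂ν₃‖ₑ ^ (2 : ℝ) ∂(ν₁.prod ν₂) ≤
      12 * Q * (mixedNorm 4 (8 / 3) f₁ ^ (2 : ℝ) * mixedNorm 4 (8 / 3) f₂ ^ (2 : ℝ)) := by
    refine (lintegral_enorm_integral_sq_le (ν₁.prod ν₂) ν₃ hgm.stronglyMeasurable hgb).trans
      ((lintegral_mono_ae hpair).trans ?_)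
    have hW : ∀ {f : ℝ × ℝ → ℂ}, Measurable f →
        Measurable fun p => (rieszKernel (p.1 - p.2) * U f p) ^ (1 / 2 : ℝ) := fun hf =>
      (hkm.mul (hUm hf)).pow_const _
    have hW₂ : Measurable fun p => (rieszKernel (p.1 - p.2) * U f₁ p) ^ (1 / 2 : ℝ) *
        (rieszKernel (p.1 - p.2) * U f₂ p) ^ (1 / 2 : ℝ) := (hW hf₁).mul (hW hf₂)
    rw [lintegral_const_mul _ hW₂]
    have cs := ENNReal.lintegral_mul_le_sqrt_mul_sqrt (ν₃.prod ν₃)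
      (hW hf₁).aemeasurable (hW hf₂).aemeasurable
    simp only [← ENNReal.rpow_mul] at cs
    norm_num at cs
    calc _ ≤ Q * ((12 * mixedNorm 4 (8 / 3) f₁ ^ (4 : ℝ)) ^ (1 / 2 : ℝ) *
          (12 * mixedNorm 4 (8 / 3) f₂ ^ (4 : ℝ)) ^ (1 / 2 : ℝ)) := by
          gcongr
          refine cs.trans ?_
          gcongr
          · exact hHLS hf₁
          · exact hHLS hf₂
      _ = _ := by
          rw [ENNReal.mul_rpow_of_nonneg _ _ (by norm_num),
            ENNReal.mul_rpow_of_nonneg _ _ (by norm_num), ← ENNReal.rpow_mul, ← ENNReal.rpow_mul]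
          have h12 : (12 : ℝ≥0∞) = 12 ^ (1 / 2 : ℝ) * 12 ^ (1 / 2 : ℝ) := by
            rw [← ENNReal.rpow_add_of_nonneg _ _ (by norm_num) (by norm_num)]
            norm_num
          conv_rhs => rw [h12]
          norm_num
          ring
  rw [hΛ]
  refine (enorm_integral_mul_le_sqrt_mul_sqrt _ hf₃.aestronglyMeasurable
    hgm.stronglyMeasurable.integral_prod_right.aestronglyMeasurable).trans ?_
  have h3 : (∫⁻ p, ‖f₃ p‖ₑ ^ (2 : ℝ) ∂(ν₁.prod ν₂)) ^ (1 / 2 : ℝ) ≤ eLpNorm f₃ 2 volume := by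
    rw [eLpNorm_eq_lintegral_rpow_enorm_toReal (by norm_num) (by norm_num), ENNReal.toReal_ofNat]
    gcongr
    rw [Measure.prod_restrict]
    exact Measure.restrict_le_self
  calc _ ≤ eLpNorm f₃ 2 volume * (12 * Q * (mixedNorm 4 (8 / 3) f₁ ^ (2 : ℝ) *
        mixedNorm 4 (8 / 3) f₂ ^ (2 : ℝ))) ^ (1 / 2 : ℝ) := by gcongr
    _ = _ := by
      rw [ENNReal.mul_rpow_of_nonneg _ _ (by norm_num),
        ENNReal.mul_rpow_of_nonneg (mixedNorm 4 (8 / 3) f₁ ^ (2 : ℝ)) _ (by norm_num),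
        ← ENNReal.rpow_mul, ← ENNReal.rpow_mul]
      norm_num
      ring

/-! ### Absolute convergence, truncation and null sets. -/

theorem ENNReal.rpow_le_one_add_rpow (a : ℝ≥0∞) {r s : ℝ} (hr : 0 ≤ r) (hrs : r ≤ s) :
    a ^ r ≤ 1 + a ^ s := by
  rcases le_total a 1 with h | h
  · exact (ENNReal.rpow_le_one h hr).trans le_self_add
  · exact (ENNReal.rpow_le_rpow_of_exponent_le h hrs).trans le_add_self

/-- Only finiteness is needed, so on finite measures `a² ≤ 1 + a^{8/3}` inside and `a ≤ 1 + a^{3/2}`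
outside take the place of Hölder's inequality. -/
theorem lintegral_lintegral_sq_lt_top_of_mixedNorm {f : ℝ × ℝ → ℂ}
    (h : mixedNorm 4 (8 / 3) f < ⊤) (μ ν : Measure ℝ) [IsFiniteMeasure μ] [IsFiniteMeasure ν]
    (hμ : μ ≤ volume) (hν : ν ≤ volume) :
    ∫⁻ y, ∫⁻ z, ‖f (y, z)‖ₑ ^ (2 : ℝ) ∂ν ∂μ < ⊤ := by
  have h4 : ∫⁻ y, (∫⁻ z, ‖f (y, z)‖ₑ ^ (8 / 3 : ℝ)) ^ (3 / 2 : ℝ) < ⊤ := by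
    unfold mixedNorm at h
    rw [ENNReal.rpow_lt_top_iff_of_pos (by norm_num)] at h
    norm_num at h
    exact h
  have h4' : ∫⁻ y, (∫⁻ z, ‖f (y, z)‖ₑ ^ (8 / 3 : ℝ)) ^ (3 / 2 : ℝ) ∂μ < ⊤ :=
    (lintegral_mono' hμ le_rfl).trans_lt h4
  calc ∫⁻ y, ∫⁻ z, ‖f (y, z)‖ₑ ^ (2 : ℝ) ∂ν ∂μ
      ≤ ∫⁻ y, (ν Set.univ + 1 + (∫⁻ z, ‖f (y, z)‖ₑ ^ (8 / 3 : ℝ)) ^ (3 / 2 : ℝ)) ∂μ := by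
        refine lintegral_mono fun y => ?_
        calc ∫⁻ z, ‖f (y, z)‖ₑ ^ (2 : ℝ) ∂ν
            ≤ ∫⁻ z, (1 + ‖f (y, z)‖ₑ ^ (8 / 3 : ℝ)) ∂ν := lintegral_mono fun z =>
              ENNReal.rpow_le_one_add_rpow _ (by norm_num) (by norm_num)
          _ = ν Set.univ + ∫⁻ z, ‖f (y, z)‖ₑ ^ (8 / 3 : ℝ) ∂ν := by
              rw [lintegral_add_left measurable_const, lintegral_one]
          _ ≤ ν Set.univ + ∫⁻ z, ‖f (y, z)‖ₑ ^ (8 / 3 : ℝ) := by gcongr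
          _ ≤ _ := by
              rw [add_assoc]
              gcongr
              refine le_trans (ENNReal.rpow_one _).ge
                (ENNReal.rpow_le_one_add_rpow _ (by norm_num) (by norm_num))
    _ = (ν Set.univ + 1) * μ Set.univ +
        ∫⁻ y, (∫⁻ z, ‖f (y, z)‖ₑ ^ (8 / 3 : ℝ)) ^ (3 / 2 : ℝ) ∂μ := by
        rw [lintegral_add_left measurable_const, lintegral_const]
    _ < ⊤ := ENNReal.add_lt_top.2 ⟨ENNReal.mul_lt_top
        (ENNReal.add_lt_top.2 ⟨measure_lt_top _ _, ENNReal.one_lt_top⟩) (measure_lt_top _ _), h4'⟩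

/-- On the bounding box, Cauchy–Schwarz in `x₃` and then in `(x₁, x₂)` separates the functions,
leaving local `L²` norms that are finite. -/
theorem integrable_integrand3 {lam : ℝ} {S : R3 → ℝ} {ψ : R3 → ℂ} {M : ℝ} {lo hi : R3}
    (hE : Continuous (oscAmplitude lam S ψ)) (hψ : ∀ x, ‖ψ x‖ ≤ M)
    (hbox : tsupport ψ ⊆ Set.Icc lo hi) {f₁ f₂ f₃ : ℝ × ℝ → ℂ}
    (hf₁ : Measurable f₁) (hf₂ : Measurable f₂) (hf₃ : Measurable f₃)
    (h₁ : mixedNorm 4 (8 / 3) f₁ < ⊤) (h₂ : mixedNorm 4 (8 / 3) f₂ < ⊤)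
    (h₃ : eLpNorm f₃ 2 volume < ⊤) :
    Integrable (integrand3 lam S ψ f₁ f₂ f₃) volume := by
  have hsupp : Function.support (integrand3 lam S ψ f₁ f₂ f₃) ⊆ Set.Icc lo hi := fun x hx => by
    by_contra hn
    exact hx (integrand3_eq_zero_of_notMem hbox f₁ f₂ f₃ x hn)
  have hm : Measurable (integrand3 lam S ψ f₁ f₂ f₃) :=
    hE.measurable.mul (((hf₁.comp (by fun_prop : Measurable fun x : R3 => (x.2.1, x.2.2))).mul
      (hf₂.comp (by fun_prop : Measurable fun x : R3 => (x.1, x.2.2)))).mul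
      (hf₃.comp (by fun_prop : Measurable fun x : R3 => (x.1, x.2.1))))
  rw [← integrableOn_iff_integrable_of_support_subset hsupp]
  refine ⟨hm.aestronglyMeasurable, ?_⟩
  set ν₁ := (volume : Measure ℝ).restrict (Set.Icc lo.1 hi.1)
  set ν₂ := (volume : Measure ℝ).restrict (Set.Icc lo.2.1 hi.2.1)
  set ν₃ := (volume : Measure ℝ).restrict (Set.Icc lo.2.2 hi.2.2)
  rw [hasFiniteIntegral_iff_enorm, restrict_Icc_eq_prod,
    ← (measurePreserving_prodAssoc ν₁ ν₂ ν₃).lintegral_comp hm.enorm]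
  have hsq : ∀ {f : ℝ × ℝ → ℂ}, Measurable f → Measurable fun q => ‖f q‖ₑ ^ (2 : ℝ) := fun hf =>
    hf.enorm.pow_const _
  set a : (ℝ × ℝ → ℂ) → ℝ → ℝ≥0∞ := fun f y => ∫⁻ z, ‖f (y, z)‖ₑ ^ (2 : ℝ) ∂ν₃ with ha
  have ham : ∀ {f : ℝ × ℝ → ℂ}, Measurable f → Measurable (a f) := fun hf =>
    (hsq hf).lintegral_prod_right'
  have hG : Measurable fun q : (ℝ × ℝ) × ℝ =>
      ENNReal.ofReal M * (‖f₃ q.1‖ₑ * (‖f₁ (q.1.2, q.2)‖ₑ * ‖f₂ (q.1.1, q.2)‖ₑ)) := by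
    fun_prop
  have hA : Measurable fun p : ℝ × ℝ => a f₁ p.2 ^ (1 / 2 : ℝ) * a f₂ p.1 ^ (1 / 2 : ℝ) :=
    (((ham hf₁).comp measurable_snd).pow_const _).mul (((ham hf₂).comp measurable_fst).pow_const _)
  calc ∫⁻ q, ‖integrand3 lam S ψ f₁ f₂ f₃ (MeasurableEquiv.prodAssoc q)‖ₑ ∂((ν₁.prod ν₂).prod ν₃)
      ≤ ∫⁻ q, ENNReal.ofReal M * (‖f₃ q.1‖ₑ * (‖f₁ (q.1.2, q.2)‖ₑ * ‖f₂ (q.1.1, q.2)‖ₑ))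
          ∂((ν₁.prod ν₂).prod ν₃) := by
        refine lintegral_mono fun q => ?_
        obtain ⟨⟨x, y⟩, z⟩ := q
        change ‖oscAmplitude lam S ψ (x, y, z) * (f₁ (y, z) * f₂ (x, z) * f₃ (x, y))‖ₑ ≤ _
        rw [enorm_mul, enorm_mul, enorm_mul, mul_comm ‖f₃ (x, y)‖ₑ]
        gcongr
        rw [← ofReal_norm, norm_oscAmplitude]
        exact ENNReal.ofReal_le_ofReal (hψ _)
    _ = ENNReal.ofReal M * ∫⁻ p, ‖f₃ p‖ₑ * ∫⁻ z, ‖f₁ (p.2, z)‖ₑ * ‖f₂ (p.1, z)‖ₑ ∂ν₃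
          ∂(ν₁.prod ν₂) := by
        rw [lintegral_const_mul _ (by fun_prop), lintegral_prod _ (by fun_prop)]
        congr 1
        refine lintegral_congr fun p => ?_
        dsimp only
        rw [lintegral_const_mul _ (by fun_prop)]
    _ ≤ ENNReal.ofReal M * ∫⁻ p, ‖f₃ p‖ₑ * (a f₁ p.2 ^ (1 / 2 : ℝ) * a f₂ p.1 ^ (1 / 2 : ℝ))
          ∂(ν₁.prod ν₂) := by
        gcongr with p
        exact ENNReal.lintegral_mul_le_sqrt_mul_sqrt ν₃ (by fun_prop) (by fun_prop)
    _ ≤ ENNReal.ofReal M * ((∫⁻ p, ‖f₃ p‖ₑ ^ (2 : ℝ) ∂(ν₁.prod ν₂)) ^ (1 / 2 : ℝ) *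
          (∫⁻ p, a f₂ p.1 * a f₁ p.2 ∂(ν₁.prod ν₂)) ^ (1 / 2 : ℝ)) := by
        gcongr
        refine (ENNReal.lintegral_mul_le_sqrt_mul_sqrt _ hf₃.enorm.aemeasurable
          hA.aemeasurable).trans_eq ?_
        congr 3 with p
        rw [ENNReal.mul_rpow_of_nonneg _ _ (by norm_num), ← ENNReal.rpow_mul, ← ENNReal.rpow_mul]
        norm_num
        ring
    _ < ⊤ := by
        rw [lintegral_prod_mul (ham hf₂).aemeasurable (ham hf₁).aemeasurable]
        refine ENNReal.mul_lt_top ENNReal.ofReal_lt_top (ENNReal.mul_lt_top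
          (lt_of_le_of_lt ?_ h₃) (ENNReal.rpow_lt_top_of_nonneg (by norm_num)
            (ENNReal.mul_lt_top ?_ ?_).ne))
        · rw [eLpNorm_eq_lintegral_rpow_enorm_toReal (by norm_num) (by norm_num),
            ENNReal.toReal_ofNat]
          gcongr
          rw [Measure.prod_restrict]
          exact Measure.restrict_le_self
        · exact lintegral_lintegral_sq_lt_top_of_mixedNorm h₂ ν₁ ν₃
            Measure.restrict_le_self Measure.restrict_le_self
        · exact lintegral_lintegral_sq_lt_top_of_mixedNorm h₁ ν₂ ν₃
            Measure.restrict_le_self Measure.restrict_le_self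

/-- Truncation of a function at height `n`. -/
noncomputable def truncate (n : ℕ) (f : ℝ × ℝ → ℂ) (q : ℝ × ℝ) : ℂ := if ‖f q‖ ≤ n then f q else 0

theorem measurable_truncate {f : ℝ × ℝ → ℂ} (hf : Measurable f) (n : ℕ) :
    Measurable (truncate n f) :=
  Measurable.ite (measurableSet_le hf.norm measurable_const) hf measurable_const

theorem norm_truncate_le_natCast (n : ℕ) (f : ℝ × ℝ → ℂ) (q : ℝ × ℝ) : ‖truncate n f q‖ ≤ n := by
  unfold truncate
  split_ifs with h
  · exact h
  · simp

theorem norm_truncate_le (n : ℕ) (f : ℝ × ℝ → ℂ) (q : ℝ × ℝ) : ‖truncate n f q‖ ≤ ‖f q‖ := by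
  unfold truncate
  split_ifs <;> simp

theorem eventually_truncate_eq (f : ℝ × ℝ → ℂ) (q : ℝ × ℝ) :
    ∀ᶠ n : ℕ in Filter.atTop, truncate n f q = f q := by
  obtain ⟨N, hN⟩ := exists_nat_ge ‖f q‖
  filter_upwards [Filter.eventually_ge_atTop N] with n hn
  exact if_pos (hN.trans (by exact_mod_cast hn))

theorem mixedNorm_mono {f g : ℝ × ℝ → ℂ} (h : ∀ q, ‖f q‖ ≤ ‖g q‖) :
    mixedNorm 4 (8 / 3) f ≤ mixedNorm 4 (8 / 3) g := by
  unfold mixedNorm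
  gcongr with x y
  exact enorm_le_iff_norm_le.2 (h _)

theorem mixedNorm_congr_ae {f g : ℝ × ℝ → ℂ} (p q : ℝ) (h : f =ᵐ[volume] g) :
    mixedNorm p q f = mixedNorm p q g := by
  unfold mixedNorm
  congr 1
  refine lintegral_congr_ae ?_
  filter_upwards [Measure.ae_ae_of_ae_prod h] with x hx
  congr 1
  refine lintegral_congr_ae ?_
  filter_upwards [hx] with y hy
  rw [hy]

/-- Changing `f_j` on a null set of the plane is harmless because the coordinate projections pull
null sets back to null sets. -/
theorem integrand3_congr_ae (lam : ℝ) (S : R3 → ℝ) (ψ : R3 → ℂ) {f₁ f₂ f₃ g₁ g₂ g₃ : ℝ × ℝ → ℂ}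
    (h₁ : f₁ =ᵐ[volume] g₁) (h₂ : f₂ =ᵐ[volume] g₂) (h₃ : f₃ =ᵐ[volume] g₃) :
    integrand3 lam S ψ f₁ f₂ f₃ =ᵐ[volume] integrand3 lam S ψ g₁ g₂ g₃ := by
  have q₁ : Measure.QuasiMeasurePreserving (fun x : R3 => x.2) volume volume :=
    Measure.quasiMeasurePreserving_snd
  have q₃ : Measure.QuasiMeasurePreserving (fun x : R3 => (x.1, x.2.1)) volume volume :=
    (Measure.quasiMeasurePreserving_fst
      (μ := (volume : Measure (ℝ × ℝ))) (ν := (volume : Measure ℝ))).comp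
      (measurePreserving_prodAssoc (volume : Measure ℝ) volume volume).symm.quasiMeasurePreserving
  have q₂ : Measure.QuasiMeasurePreserving (fun x : R3 => (x.1, x.2.2)) volume volume :=
    q₃.comp ((MeasurePreserving.id (volume : Measure ℝ)).prod
      (Measure.measurePreserving_swap (μ := (volume : Measure ℝ))
        (ν := (volume : Measure ℝ)))).quasiMeasurePreserving
  filter_upwards [q₁.ae h₁, q₂.ae h₂, q₃.ae h₃] with x e₁ e₂ e₃
  simp only [integrand3]
  rw [e₂, e₃]
  change _ * (f₁ x.2 * _ * _) = _
  rw [e₁]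

/-- The bound for truncated functions has no dependence on the height and truncation increases no
norm, so it survives the limit. Dominated convergence uses the full integrand as majorant. -/
theorem trilinear_estimate_of_measurable {lam μ b C₁ C₂ : ℝ} {S : R3 → ℝ} {ψ : R3 → ℂ}
    (hlam : lam ≠ 0) (hμ : 0 < μ) (hb : 0 < b) (hC₂ : 0 < C₂) (hψ : ContDiff ℝ ∞ ψ)
    (hS : AnalyticOnNhd ℝ S (convexHull ℝ (tsupport ψ)))
    (h : LocalEstimateHyp 0 S ψ b μ C₁ C₂)
    {f₁ f₂ f₃ : ℝ × ℝ → ℂ} (hf₁ : Measurable f₁) (hf₂ : Measurable f₂) (hf₃ : Measurable f₃)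
    (h₁ : mixedNorm 4 (8 / 3) f₁ < ⊤) (h₂ : mixedNorm 4 (8 / 3) f₂ < ⊤)
    (h₃ : eLpNorm f₃ 2 volume < ⊤) :
    Integrable (integrand3 lam S ψ f₁ f₂ f₃) volume ∧
    ‖Lambda3 lam S ψ f₁ f₂ f₃‖ₑ ≤
      (12 * ENNReal.ofReal ((4 * Real.pi * kernelConst C₁ C₂ * (|lam| * μ)⁻¹) ^ (1 / 2 : ℝ))) ^
        (1 / 2 : ℝ) * mixedNorm 4 (8 / 3) f₁ * mixedNorm 4 (8 / 3) f₂ * eLpNorm f₃ 2 volume := by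
  obtain ⟨lo, hi, -, hbox⟩ := h.support_subset
  have hE := continuous_oscAmplitude lam hψ.continuous hS
  have hψ0 : ∀ x, ‖ψ x‖ ≤ C₁ := fun x => by simpa using h.cutoff_bound 0 (by norm_num) x
  have hint := integrable_integrand3 hE hψ0 hbox hf₁ hf₂ hf₃ h₁ h₂ h₃
  refine ⟨hint, ?_⟩
  have hlim : Filter.Tendsto
      (fun n => Lambda3 lam S ψ (truncate n f₁) (truncate n f₂) (truncate n f₃)) Filter.atTop
      (nhds (Lambda3 lam S ψ f₁ f₂ f₃)) := by
    refine tendsto_integral_of_dominated_convergence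
      (fun x => ‖integrand3 lam S ψ f₁ f₂ f₃ x‖) (fun n => ?_) hint.norm
      (fun n => Filter.Eventually.of_forall fun x => ?_) (Filter.Eventually.of_forall fun x => ?_)
    · exact (hE.measurable.mul ((((measurable_truncate hf₁ n).comp
        (by fun_prop : Measurable fun x : R3 => (x.2.1, x.2.2))).mul
        ((measurable_truncate hf₂ n).comp (by fun_prop : Measurable fun x : R3 => (x.1, x.2.2)))).mul
        ((measurable_truncate hf₃ n).comp
          (by fun_prop : Measurable fun x : R3 => (x.1, x.2.1))))).aestronglyMeasurable
    · simp only [integrand3, norm_mul]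
      gcongr <;> exact norm_truncate_le _ _ _
    · refine tendsto_const_nhds.congr' ?_
      filter_upwards [eventually_truncate_eq f₁ (x.2.1, x.2.2),
        eventually_truncate_eq f₂ (x.1, x.2.2), eventually_truncate_eq f₃ (x.1, x.2.1)]
        with n e₁ e₂ e₃
      simp only [integrand3, e₁, e₂, e₃]
  refine le_of_tendsto hlim.enorm (Filter.Eventually.of_forall fun n => ?_)
  refine (enorm_Lambda3_le_of_bounded hlam hμ hb hC₂ hψ hS h (measurable_truncate hf₁ n)
    (measurable_truncate hf₂ n) (measurable_truncate hf₃ n) (norm_truncate_le_natCast n f₁)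
    (norm_truncate_le_natCast n f₂) (norm_truncate_le_natCast n f₃)).trans ?_
  gcongr
  · exact mixedNorm_mono (norm_truncate_le n f₁)
  · exact mixedNorm_mono (norm_truncate_le n f₂)
  · exact eLpNorm_mono (norm_truncate_le n f₃)

/-! ### The theorem for almost everywhere strongly measurable functions. -/

theorem mainTheorem5 (C₁ C₂ : ℝ) (hC₁ : 0 < C₁) (hC₂ : 0 < C₂) :
    ∃ C : ℝ, 0 < C ∧
      ∀ (lam μ b : ℝ) (S : R3 → ℝ) (ψ : R3 → ℂ) (f₁ f₂ f₃ : ℝ × ℝ → ℂ),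
        lam ≠ 0 → 0 < μ → 0 < b →
        ContDiff ℝ ∞ ψ → HasCompactSupport ψ →
        AnalyticOnNhd ℝ S (convexHull ℝ (tsupport ψ)) →
        LocalEstimateHyp 0 S ψ b μ C₁ C₂ →
        AEStronglyMeasurable f₁ volume → mixedNorm 4 (8 / 3) f₁ < ⊤ →
        AEStronglyMeasurable f₂ volume → mixedNorm 4 (8 / 3) f₂ < ⊤ →
        MemLp f₃ 2 volume →
        Integrable (integrand3 lam S ψ f₁ f₂ f₃) volume ∧
        ‖Lambda3 lam S ψ f₁ f₂ f₃‖ₑ ≤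
          ENNReal.ofReal (C * (|lam| * μ) ^ (-(1 / 4) : ℝ)) *
            mixedNorm 4 (8 / 3) f₁ * mixedNorm 4 (8 / 3) f₂ * eLpNorm f₃ 2 volume := by
  have hD : 0 < kernelConst C₁ C₂ := by unfold kernelConst; positivity
  -- The `12` comes from Hardy–Littlewood–Sobolev and `4π` times the kernel constant from the slice
  -- estimate; the final square root of `‖G‖₂²` halves their exponents.
  refine ⟨12 ^ (1 / 2 : ℝ) * (4 * Real.pi * kernelConst C₁ C₂) ^ (1 / 4 : ℝ), by positivity, ?_⟩
  intro lam μ b S ψ f₁ f₂ f₃ hlam hμ hb hψ _ hS h hf₁ h₁ hf₂ h₂ ⟨hf₃, h₃⟩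
  have hL : 0 < |lam| * μ := mul_pos (abs_pos.2 hlam) hμ
  have hconst : (12 * ENNReal.ofReal
      ((4 * Real.pi * kernelConst C₁ C₂ * (|lam| * μ)⁻¹) ^ (1 / 2 : ℝ))) ^ (1 / 2 : ℝ) =
      ENNReal.ofReal (12 ^ (1 / 2 : ℝ) * (4 * Real.pi * kernelConst C₁ C₂) ^ (1 / 4 : ℝ) *
        (|lam| * μ) ^ (-(1 / 4) : ℝ)) := by
    rw [show (12 : ℝ≥0∞) = ENNReal.ofReal 12 by simp, ← ENNReal.ofReal_mul (by norm_num),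
      ENNReal.ofReal_rpow_of_pos (by positivity), Real.mul_rpow (by norm_num) (by positivity),
      ← Real.rpow_mul (by positivity), Real.mul_rpow (by positivity) (by positivity),
      Real.rpow_neg hL.le, Real.inv_rpow hL.le, mul_assoc]
    norm_num
    congr 1
    ring
  have e₁ := hf₁.ae_eq_mk
  have e₂ := hf₂.ae_eq_mk
  have e₃ := hf₃.ae_eq_mk
  have ei := integrand3_congr_ae lam S ψ e₁ e₂ e₃
  have key := trilinear_estimate_of_measurable hlam hμ hb hC₂ hψ hS h
    hf₁.stronglyMeasurable_mk.measurable hf₂.stronglyMeasurable_mk.measurable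
    hf₃.stronglyMeasurable_mk.measurable
    (mixedNorm_congr_ae _ _ e₁ ▸ h₁) (mixedNorm_congr_ae _ _ e₂ ▸ h₂)
    (eLpNorm_congr_ae e₃ ▸ h₃)
  refine ⟨key.1.congr ei.symm, ?_⟩
  rw [Lambda3, integral_congr_ae ei, mixedNorm_congr_ae _ _ e₁, mixedNorm_congr_ae _ _ e₂,
    eLpNorm_congr_ae e₃, ← hconst]
  exact key.2
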